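/- Let $p$ be a prime, $G\cong C_p\times C_p$, and $N\leqslant G$ a subgroup of order $p$. A $\mathbb{Z}_p$-module is a *lattice* if it is free of finite rank over $\mathbb{Z}_p$, and a $\mathbb{Z}_pG$-module is a *permutation module* if it has a finite $\mathbb{Z}_p$-basis that is preserved as a set by $G$. For $H\leqslant G$ put $\widehat H=\sum_{h\in H}h$, and let $I_H$ be the ideal of $\mathbb{Z}_pG$ generated by the kernel of the augmentation map $\mathbb{Z}_pH\to\mathbb{Z}_p$. Write $U_N=U/I_NU$ for the $N$-coinvariants of a $\mathbb{Z}_pG$-module $U$. Let $I$ be the set consisting of the symbol $0$ and the $p+1$ subgroups of $G$ of order $p$. In $\mathbb{Q}_pG$ let $e_0=\frac1{p^2}\widehat G$ and, for $H$ of order $p$, $e_H=\frac1{p^2}(p\widehat H-\widehat G)$. For $i\in I$ let $\Lambda_{(i)}=e_i\mathbb{Z}_pG$. A $\mathbb{Z}_pG$-lattice $U$ is *reduced* if it has no non-zero free direct summand and no direct summand isomorphic to some $\Lambda_{(i)}$, $i\in I$. For a reduced lattice $U$, regarded as the sublattice $1\otimes U$ of $\mathbb{Q}_p\otimes_{\mathbb{Z}_p}U$,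 put $U_{(i)}=e_iU$ for $i\in I$, $U_*=\sum_{i\in I}U_{(i)}$, $V=U_*/U$ and $V_{(i)}=(U_{(i)}+U)/U\subseteq V$. **Theorem.** Let $U$ be a reduced $\mathbb{Z}_pG$-lattice such that $U_N$ is a lattice. Then $U_N$ is a permutation module if and only if $$V_{(H)}\cap\sum_{K\neq H}V_{(K)}\subseteq I_GV_{(H)}$$ for every subgroup $H\leqslant G$ of order $p$, where the sum runs over the subgroups $K$ of $G$ of order $p$ different from $H$ (the index $0$ is not included). -/

import Mathlib

open scoped TensorProduct

noncomputable section

namespace ButlerDiagram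

section Elements

variable (p : ℕ) [Fact p.Prime] {G : Type*} [CommGroup G]

/-- The element `Ĥ = ∑_{h ∈ H} h` of the group algebra `R[G]` (used for finite `G` only). -/
def hat (R : Type*) [CommRing R] (H : Subgroup G) : MonoidAlgebra R G :=
  ∑ᶠ h : H, MonoidAlgebra.of R G (h : G)

variable (G) in
/-- The subgroups of order `p` of `G`. -/
abbrev OrderP : Type _ := {H : Subgroup G // Nat.card H = p}

/-- The idempotents of `ℚ_p G`, for `G ≅ C_p × C_p`, indexed by `0` (here `none`) and by the
subgroups of order `p`: `e_0 = Ĝ / p²` and `e_H = (p Ĥ - Ĝ) / p²`. -/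
def idem : Option (OrderP p G) → MonoidAlgebra ℚ_[p] G
  | none => (1 / (p : ℚ_[p]) ^ 2) • hat ℚ_[p] (⊤ : Subgroup G)
  | some H => (1 / (p : ℚ_[p]) ^ 2) •
      ((p : ℚ_[p]) • hat ℚ_[p] H.1 - hat ℚ_[p] (⊤ : Subgroup G))

open scoped AlgebraMonoidAlgebra in
/-- `Λ_(i) = e_i ℤ_p G`, as a `ℤ_p G`-submodule of `ℚ_p G`. -/
def Lam (i : Option (OrderP p G)) :
    Submodule (MonoidAlgebra ℤ_[p] G) (MonoidAlgebra ℚ_[p] G) :=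
  Submodule.span (MonoidAlgebra ℤ_[p] G) {idem p i}

/-- For a subgroup `N`, the ideal `I_N` of `ℤ_p G` generated by the kernel of the augmentation
map `ℤ_p N → ℤ_p`, `∑ λ_n n ↦ ∑ λ_n`. In particular `I_G` is `augIdeal p ⊤`. -/
def augIdeal (N : Subgroup G) : Ideal (MonoidAlgebra ℤ_[p] G) :=
  (RingHom.ker (MonoidAlgebra.lift ℤ_[p] ℤ_[p] N (1 : N →* ℤ_[p]))).map
    (MonoidAlgebra.mapDomainRingHom ℤ_[p] N.subtype)

end Elements

section Modules

variable (p : ℕ) [Fact p.Prime] (G : Type*) [CommGroup G]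
  (U : Type*) [AddCommGroup U] [Module ℤ_[p] U] [Module (MonoidAlgebra ℤ_[p] G) U]

/-- A module is a lattice if it is free of finite rank over `ℤ_p`. -/
def IsLattice (M : Type*) [AddCommGroup M] [Module ℤ_[p] M] : Prop :=
  Module.Free ℤ_[p] M ∧ Module.Finite ℤ_[p] M

/-- A permutation module: there is a (finite) `ℤ_p`-basis which is preserved, as a set, by
multiplication by elements of `G`. -/
def IsPermutationModule : Prop :=
  ∃ (n : ℕ) (b : Module.Basis (Fin n) ℤ_[p] U),
    ∀ (g : G) (i : Fin n), ∃ j : Fin n, MonoidAlgebra.of ℤ_[p] G g • b i = b j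

/-- `U` is reduced if it has no (non-zero) free direct summands, and no direct summands isomorphic
to some `Λ_(i)`. -/
def IsReduced : Prop :=
  ∀ W W' : Submodule (MonoidAlgebra ℤ_[p] G) U, IsCompl W W' →
    (Module.Free (MonoidAlgebra ℤ_[p] G) W → W = ⊥) ∧
    ∀ i : Option (OrderP p G), IsEmpty (W ≃ₗ[MonoidAlgebra ℤ_[p] G] Lam p i)

variable {G} in
/-- The coinvariants `U_N = U / I_N U`. -/
abbrev Coinv (N : Subgroup G) : Type _ :=
  U ⧸ (augIdeal p N • (⊤ : Submodule (MonoidAlgebra ℤ_[p] G) U))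

variable [IsScalarTower ℤ_[p] (MonoidAlgebra ℤ_[p] G) U]

/-- `ℚ_p U`, the extension of scalars of `U` to `ℚ_p`, written with the factor `U` on the left.
It is a `ℤ_p G`-module through the factor `U`. -/
abbrev QExt : Type _ := U ⊗[ℤ_[p]] ℚ_[p]

variable {G} in
/-- The action on `ℚ_p U` of an element `x = ∑ x_g g` of `ℚ_p G`:
`x • (u ⊗ q) = ∑ g u ⊗ x_g q`. -/
def qAct (x : MonoidAlgebra ℚ_[p] G) :
    QExt p U →ₗ[MonoidAlgebra ℤ_[p] G] QExt p U :=
  x.coeff.sum fun g a => MonoidAlgebra.of ℤ_[p] G g •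
    TensorProduct.AlgebraTensorModule.map
      (LinearMap.id : U →ₗ[MonoidAlgebra ℤ_[p] G] U) (LinearMap.mulLeft ℤ_[p] a)

/-- `U` regarded as the sublattice `{u ⊗ 1}` of `ℚ_p U`. -/
def latIn : Submodule (MonoidAlgebra ℤ_[p] G) (QExt p U) :=
  LinearMap.range ((TensorProduct.AlgebraTensorModule.mk ℤ_[p] (MonoidAlgebra ℤ_[p] G)
    U ℚ_[p]).flip 1)

variable {G} in
/-- `U_(i) = e_i U`. -/
def comp (i : Option (OrderP p G)) : Submodule (MonoidAlgebra ℤ_[p] G) (QExt p U) :=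
  (latIn p G U).map (qAct p U (idem p i))

/-- `U_* = ∑ U_(i)`. -/
def star : Submodule (MonoidAlgebra ℤ_[p] G) (QExt p U) :=
  ⨆ i : Option (OrderP p G), comp p U i

/-- `V = U_* / U`. -/
abbrev V : Type _ := star p G U ⧸ (latIn p G U).submoduleOf (star p G U)

variable {G} in
/-- `V_(i) = (U_(i) + U) / U`. -/
def Vcomp (i : Option (OrderP p G)) : Submodule (MonoidAlgebra ℤ_[p] G) (V p G U) :=
  ((comp p U i ⊔ latIn p G U).submoduleOf (star p G U)).map
    ((latIn p G U).submoduleOf (star p G U)).mkQ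

end Modules

end ButlerDiagram

end

/-! Both sides are compared with the vanishing of Tate cohomology in degree -1: every `u` in `U`
with `Ĝu = 0` lies in `I_G U`. As `I_N ⊆ I_G`, this is a statement about `U_N` as well as about `U`
(`mk_mem_augIdeal_smul_iff`). Permutation modules have this vanishing
(`mem_augIdeal_smul_of_isPermutationModule`). Conversely, on the lattice `U_N` the group acts
through a group of order `p`, where vanishing forces a permutation module
(`isPermutationModule_of_cyclic`, `isPermutationModule_of_fixed`).

Vanishing gives the condition on `V` for every `H`: a coincidence of classes in `V` is an element `w
= e_H u - z` of `U` with `e_0 w = 0` and `e_H z = 0`; then `w ∈ I_G U` and `e_H w = e_H u`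
(`Vcomp_inf_iSup_le`).

For the converse let `Ĝu = 0`. The condition at `H = N` gives `e_N u = e_N w + x` with `w ∈ I_G U`
and `x ∈ U ∩ e_N U` (`exists_scaledIdem_smul_eq`). If `x` were not in `e_N I_G U`, it would generate
a direct summand `Λ_(N)` (`exists_isCompl_of_notMem`), against reducedness. So after changing `w`,
`e_N (u - w) = 0`, that is `N̂(u - w) = 0`. On `U_N` the element `N̂` is multiplication by `p`, and
`U_N` is torsion-free, so `u - w ∈ I_N U` and `u ∈ I_G U`. -/

noncomputable section

namespace ButlerDiagram

/-! ### Locality of the group algebra, augmentation ideals and norm elements. -/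

section GroupAlgebra

variable {p : ℕ} [Fact p.Prime] {G : Type*} [CommGroup G]

/-- The augmentation `ℤ_p G → ℤ_p`. -/
def aug : MonoidAlgebra ℤ_[p] G →ₐ[ℤ_[p]] ℤ_[p] :=
  MonoidAlgebra.lift ℤ_[p] ℤ_[p] G (1 : G →* ℤ_[p])

@[simp]
lemma aug_single (g : G) (a : ℤ_[p]) : aug (MonoidAlgebra.single g a) = a := by
  simp [aug]

/-- Frobenius is additive modulo `p`, and it sends every group element to 1. -/
lemma exists_pow_prime_eq (hG : ∀ g : G, g ^ p = 1) (r : MonoidAlgebra ℤ_[p] G) :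
    ∃ s, r ^ p = algebraMap ℤ_[p] _ (aug r ^ p) + p * s := by
  have hp : p.Prime := Fact.out
  induction r using MonoidAlgebra.induction_linear with
  | zero => exact ⟨0, by simp [hp.ne_zero]⟩
  | single g a =>
    refine ⟨0, ?_⟩
    simp [MonoidAlgebra.single_pow, hG, MonoidAlgebra.coe_algebraMap]
  | add x y hx hy =>
    obtain ⟨s, hs⟩ := hx
    obtain ⟨t, ht⟩ := hy
    obtain ⟨c, hc⟩ := exists_add_pow_prime_eq hp x y
    obtain ⟨d, hd⟩ := exists_add_pow_prime_eq hp (aug x) (aug y)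
    refine ⟨s + t + x * y * c - algebraMap ℤ_[p] _ (aug x * aug y * d), ?_⟩
    rw [hc, hs, ht, map_add aug, hd]
    simp only [map_add, map_mul, map_natCast]
    ring

instance [Finite G] : Module.Finite ℤ_[p] (MonoidAlgebra ℤ_[p] G) :=
  Module.Finite.of_basis (MonoidAlgebra.basis G ℤ_[p])

/-- The group algebra of a finite elementary abelian `p`-group over `ℤ_p` is local. -/
lemma isUnit_of_isUnit_aug [Finite G] (hG : ∀ g : G, g ^ p = 1) {r : MonoidAlgebra ℤ_[p] G}
    (hr : IsUnit (aug r)) : IsUnit r := by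
  have hp : p.Prime := Fact.out
  obtain ⟨s, hs⟩ := exists_pow_prime_eq hG r
  obtain ⟨c, hc⟩ := (hr.pow p).exists_left_inv
  have key : (⊤ : Submodule ℤ_[p] (MonoidAlgebra ℤ_[p] G)) ≤
      (Ideal.span {r}).restrictScalars ℤ_[p] := by
    -- Nakayama over `ℤ_p`: modulo `p`, `r ^ p` is the unit constant `aug r ^ p`, so `r` generates
    -- the unit ideal.
    refine Submodule.le_of_le_smul_of_le_jacobson_bot (I := Ideal.span {(p : ℤ_[p])})
      Module.Finite.fg_top ?_ ?_
    · rw [IsLocalRing.jacobson_eq_maximalIdeal _ bot_ne_top, ← PadicInt.maximalIdeal_eq_span_p]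
    · intro x _
      have : x = (algebraMap ℤ_[p] _ c * r ^ (p - 1) * x) * r +
          (p : ℤ_[p]) • (-(algebraMap ℤ_[p] _ c * s * x)) := by
        have h1 : r ^ (p - 1) * r = r ^ p := by
          rw [← pow_succ, Nat.sub_add_cancel hp.one_le]
        have h2 : algebraMap ℤ_[p] (MonoidAlgebra ℤ_[p] G) c *
            algebraMap ℤ_[p] _ (aug r ^ p) = 1 := by
          rw [← map_mul, hc, map_one]
        rw [Algebra.smul_def, map_natCast]
        linear_combination (-x) * h2 - algebraMap ℤ_[p] (MonoidAlgebra ℤ_[p] G) c * x * h1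
          - algebraMap ℤ_[p] (MonoidAlgebra ℤ_[p] G) c * x * hs
      rw [this]
      refine Submodule.add_mem_sup (Ideal.mul_mem_left _ _ (Ideal.mem_span_singleton_self r)) ?_
      exact Submodule.smul_mem_smul (Ideal.mem_span_singleton_self _) trivial
  have h1 : (1 : MonoidAlgebra ℤ_[p] G) ∈ Ideal.span {r} := key trivial
  exact isUnit_of_dvd_one (Ideal.mem_span_singleton.mp h1)

lemma augIdeal_le {N : Subgroup G} {J : Ideal (MonoidAlgebra ℤ_[p] G)}
    (h : ∀ g ∈ N, MonoidAlgebra.of ℤ_[p] G g - 1 ∈ J) : augIdeal p N ≤ J := by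
  rw [augIdeal, Ideal.map_le_iff_le_comap]
  intro x hx
  have key : ∀ y : MonoidAlgebra ℤ_[p] N,
      MonoidAlgebra.mapDomainRingHom ℤ_[p] N.subtype y -
        algebraMap ℤ_[p] _ (aug y) ∈ J := by
    intro y
    induction y using MonoidAlgebra.induction_linear with
    | zero => simp
    | add x y hx hy =>
      simp only [map_add, add_sub_add_comm]
      exact J.add_mem hx hy
    | single g a =>
      have := J.mul_mem_left (algebraMap ℤ_[p] _ a) (h g g.2)
      rw [mul_sub, mul_one, ← Algebra.smul_def] at this
      simpa using this
  have h0 : aug x = 0 := hx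
  simpa [h0] using key x

lemma of_sub_one_mem_augIdeal {N : Subgroup G} {g : G} (hg : g ∈ N) :
    MonoidAlgebra.of ℤ_[p] G g - 1 ∈ augIdeal p N := by
  have : MonoidAlgebra.of ℤ_[p] G g - 1 = MonoidAlgebra.mapDomainRingHom ℤ_[p] N.subtype
      (MonoidAlgebra.of ℤ_[p] N ⟨g, hg⟩ - 1) := by
    rw [map_sub, map_one]
    simp
  rw [this]
  refine Ideal.mem_map_of_mem _ ?_
  simp [RingHom.mem_ker]

lemma augIdeal_mono {N K : Subgroup G} (h : N ≤ K) : augIdeal p N ≤ augIdeal p K :=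
  augIdeal_le fun _ hg => of_sub_one_mem_augIdeal (h hg)

lemma aug_eq_zero_of_mem_augIdeal {N : Subgroup G} {x : MonoidAlgebra ℤ_[p] G}
    (hx : x ∈ augIdeal p N) : aug x = 0 := by
  have : augIdeal p N ≤ RingHom.ker (aug (p := p) (G := G)) :=
    augIdeal_le fun g _ => by simp [RingHom.mem_ker]
  exact this hx

lemma augIdeal_le_jacobson [Finite G] (hG : ∀ g : G, g ^ p = 1) (N : Subgroup G) :
    augIdeal p N ≤ Ideal.jacobson ⊥ := by
  intro x hx
  rw [Ideal.mem_jacobson_bot]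
  intro y
  refine isUnit_of_isUnit_aug hG ?_
  simp [aug_eq_zero_of_mem_augIdeal hx]

lemma hat_eq_sum (R : Type*) [CommRing R] (H : Subgroup G) [Fintype H] :
    hat R H = ∑ h : H, MonoidAlgebra.of R G (h : G) := by
  rw [hat, finsum_eq_sum_of_fintype]

lemma hat_top_eq_sum (R : Type*) [CommRing R] [Fintype G] :
    hat R (⊤ : Subgroup G) = ∑ g : G, MonoidAlgebra.of R G g := by
  have := Fintype.ofFinite (⊤ : Subgroup G)
  rw [hat_eq_sum]
  exact Fintype.sum_equiv Subgroup.topEquiv.toEquiv _ _ fun _ => rfl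

lemma of_mul_hat [Finite G] (H : Subgroup G) {g : G} (hg : g ∈ H) :
    MonoidAlgebra.of ℤ_[p] G g * hat ℤ_[p] H = hat ℤ_[p] H := by
  have := Fintype.ofFinite H
  rw [hat_eq_sum, Finset.mul_sum]
  exact Fintype.sum_equiv (Equiv.mulLeft (⟨g, hg⟩ : H)) _ _ fun h => by simp

lemma aug_hat [Finite G] (H : Subgroup G) : aug (hat ℤ_[p] H) = Nat.card H := by
  have := Fintype.ofFinite H
  rw [hat_eq_sum, map_sum]
  simp

/-- If every element of `H` fixes `m`, then `Ĥ` acts on `m` as `|H|`. -/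
lemma hat_smul_of_fixed {U : Type*} [AddCommGroup U] [Module ℤ_[p] U]
    [Module (MonoidAlgebra ℤ_[p] G) U] [Finite G] {H : Subgroup G} {m : U}
    (hm : ∀ h ∈ H, MonoidAlgebra.of ℤ_[p] G h • m = m) :
    hat ℤ_[p] H • m = (Nat.card H : ℤ_[p]) • m := by
  have := Fintype.ofFinite H
  rw [hat_eq_sum, Finset.sum_smul, Finset.sum_congr rfl fun (h : H) _ => hm h h.2]
  simp [Nat.cast_smul_eq_nsmul]

variable {U : Type*} [AddCommGroup U] [Module ℤ_[p] U] [Module (MonoidAlgebra ℤ_[p] G) U]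
  [IsScalarTower ℤ_[p] (MonoidAlgebra ℤ_[p] G) U]

/-- The `ℤ_p G`-linear map `U → ℤ_p G` corresponding to a `ℤ_p`-linear map `U → ℤ_p`. -/
def toGroupAlgebra [Fintype G] (φ : U →ₗ[ℤ_[p]] ℤ_[p]) :
    U →ₗ[MonoidAlgebra ℤ_[p] G] MonoidAlgebra ℤ_[p] G :=
  MonoidAlgebra.equivariantOfLinearOfComm
    (∑ g : G, (LinearMap.toSpanSingleton ℤ_[p] _ (MonoidAlgebra.of ℤ_[p] G g)) ∘ₗ φ ∘ₗ
      (LinearMap.lsmul _ _ (MonoidAlgebra.of ℤ_[p] G g⁻¹)).restrictScalars ℤ_[p]) <| by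
    intro h v
    simp only [LinearMap.sum_apply, LinearMap.comp_apply, Finset.smul_sum]
    refine Fintype.sum_equiv (Equiv.mulLeft h⁻¹) _ _ fun g => ?_
    simp [smul_smul, MonoidAlgebra.single_mul_single, mul_comm h]

lemma toGroupAlgebra_apply [Fintype G] (φ : U →ₗ[ℤ_[p]] ℤ_[p]) (u : U) :
    toGroupAlgebra φ u =
      ∑ g : G, φ (MonoidAlgebra.of ℤ_[p] G g⁻¹ • u) • MonoidAlgebra.of ℤ_[p] G g := by
  simp [toGroupAlgebra, LinearMap.sum_apply]

/-- With locality, this reduces invertibility in `ℤ_p G` to a computation with the norm element over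
`ℤ_p`. -/
lemma aug_toGroupAlgebra [Fintype G] (φ : U →ₗ[ℤ_[p]] ℤ_[p]) (u : U) :
    aug (toGroupAlgebra (G := G) φ u) = φ ((∑ g : G, MonoidAlgebra.of ℤ_[p] G g) • u) := by
  rw [toGroupAlgebra_apply φ u, map_sum, Finset.sum_smul, map_sum]
  exact Fintype.sum_equiv (Equiv.inv G) _
    (fun g : G => φ (MonoidAlgebra.of ℤ_[p] G g • u)) fun g => by simp

end GroupAlgebra

/-! ### Permutation modules for a group of order `p`. -/

section Cyclic

variable {p : ℕ} [Fact p.Prime] {G : Type*} [CommGroup G]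
  {L : Type*} [AddCommGroup L] [Module ℤ_[p] L] [Module (MonoidAlgebra ℤ_[p] G) L]
  [IsScalarTower ℤ_[p] (MonoidAlgebra ℤ_[p] G) L]

lemma eq_top_of_le_sup_augIdeal_smul [Finite G] [Module.Finite ℤ_[p] L]
    (hG : ∀ g : G, g ^ p = 1) (N : Subgroup G) (W : Submodule (MonoidAlgebra ℤ_[p] G) L)
    (h : ⊤ ≤ W ⊔ augIdeal p N • (⊤ : Submodule (MonoidAlgebra ℤ_[p] G) L)) : W = ⊤ := by
  have : Module.Finite (MonoidAlgebra ℤ_[p] G) L :=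
    Module.Finite.of_restrictScalars_finite ℤ_[p] _ _
  exact top_le_iff.mp (Submodule.le_of_le_smul_of_le_jacobson_bot Module.Finite.fg_top
    (augIdeal_le_jacobson hG N) h)

/-- The `ℤ_p`-span of the translates of a family of `ℤ_p G`-generators is everything. -/
lemma span_translates_eq_top {ι : Type*} (x : ι → L)
    (hx : Submodule.span (MonoidAlgebra ℤ_[p] G) (Set.range x) = ⊤)
    (S : Submodule ℤ_[p] L) (hS : ∀ (g : G) (i : ι), MonoidAlgebra.of ℤ_[p] G g • x i ∈ S) :
    S = ⊤ := by
  have key : ∀ (r : MonoidAlgebra ℤ_[p] G) (i : ι), r • x i ∈ S := by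
    intro r i
    induction r using MonoidAlgebra.induction_linear with
    | zero => simp
    | add r s hr hs => rw [add_smul]; exact S.add_mem hr hs
    | single g a =>
      rw [← MonoidAlgebra.smul_of, smul_assoc]
      exact S.smul_mem a (hS g i)
  rw [eq_top_iff]
  intro l _
  have hl : l ∈ Submodule.span (MonoidAlgebra ℤ_[p] G) (Set.range x) := hx ▸ trivial
  obtain ⟨c, rfl⟩ := (Finsupp.mem_span_range_iff_exists_finsupp).mp hl
  exact S.sum_mem fun i _ => key _ i

/-- The equivariant maps attached to the `φ i` kill every `y j`, and on the `x j` they give a matrix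
over the local ring `ℤ_p G` whose determinant has unit augmentation. The matrix is therefore
invertible, and the group algebra coefficients of the `x j` in any relation vanish. -/
lemma linearIndependent_translates [Fintype G] (hG : ∀ g : G, g ^ p = 1) {T T' : Type*}
    [Fintype T] [DecidableEq T] [Fintype T'] (x : T → L) (y : T' → L) (φ : T → L →ₗ[ℤ_[p]] ℤ_[p])
    (hφ : IsUnit (Matrix.of fun i j => φ i ((∑ g : G, MonoidAlgebra.of ℤ_[p] G g) • x j)).det)
    (hyfix : ∀ j (g : G), MonoidAlgebra.of ℤ_[p] G g • y j = y j) (hφy : ∀ i j, φ i (y j) = 0)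
    (hy : LinearIndependent ℤ_[p] y) :
    LinearIndependent ℤ_[p]
      (Sum.elim (fun t : T × G => MonoidAlgebra.of ℤ_[p] G t.2 • x t.1) y) := by
  rw [Fintype.linearIndependent_iff]
  intro g hg
  rw [Fintype.sum_sum_type, Fintype.sum_prod_type] at hg
  let α : T → MonoidAlgebra ℤ_[p] G :=
    fun i => ∑ k, g (Sum.inl (i, k)) • MonoidAlgebra.of ℤ_[p] G k
  have hα : ∑ i, α i • x i + ∑ j, g (Sum.inr j) • y j = 0 := by
    rw [← hg]
    simp only [α, Finset.sum_smul, smul_assoc, Sum.elim_inl, Sum.elim_inr]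
  let F : T → L →ₗ[MonoidAlgebra ℤ_[p] G] MonoidAlgebra ℤ_[p] G :=
    fun i => toGroupAlgebra (φ i)
  let M : Matrix T T (MonoidAlgebra ℤ_[p] G) := Matrix.of fun i j => F i (x j)
  have hM : IsUnit M := by
    rw [Matrix.isUnit_iff_isUnit_det]
    refine isUnit_of_isUnit_aug hG ?_
    rw [AlgHom.map_det]
    convert hφ using 2
    ext i j
    exact aug_toGroupAlgebra _ _
  have hFy : ∀ i j, F i (y j) = 0 := by
    intro i j
    have : F i (y j) = _ := toGroupAlgebra_apply _ _
    rw [this]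
    exact Finset.sum_eq_zero fun k _ => by rw [hyfix, hφy, zero_smul]
  have hα0 : α = 0 := by
    refine Matrix.mulVec_injective_of_isUnit hM ?_
    rw [Matrix.mulVec_zero]
    ext1 i
    have h1 := congrArg (F i) hα
    simp only [map_add, map_sum, map_smul, map_zero, LinearMap.map_smul_of_tower, hFy, smul_zero,
      Finset.sum_const_zero, add_zero] at h1
    rw [Pi.zero_apply, ← h1]
    change ∑ j, M i j * α j = ∑ j, α j * M i j
    exact Finset.sum_congr rfl fun j _ => mul_comm _ _
  rintro (⟨i, k⟩ | j)
  · have h1 : ∑ k, g (Sum.inl (i, k)) • MonoidAlgebra.basis G ℤ_[p] k = 0 := by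
      simpa [α] using congrFun hα0 i
    exact Fintype.linearIndependent_iff.mp (MonoidAlgebra.basis G ℤ_[p]).linearIndependent _ h1 k
  · simp only [hα0, Pi.zero_apply, zero_smul, Finset.sum_const_zero, zero_add] at hα
    exact Fintype.linearIndependent_iff.mp hy _ hα j

/-- A lattice for a group of order `p` with vanishing Tate cohomology in degree `-1` is a
permutation module. -/
theorem isPermutationModule_of_cyclic [Finite G] (hG : Nat.card G = p) (hL : IsLattice p L)
    (h : ∀ l : L, hat ℤ_[p] (⊤ : Subgroup G) • l = 0 →
      l ∈ augIdeal p (⊤ : Subgroup G) • (⊤ : Submodule (MonoidAlgebra ℤ_[p] G) L)) :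
    IsPermutationModule p G L := by
  classical
  have := Fintype.ofFinite G
  have hp : p.Prime := Fact.out
  obtain ⟨_, _⟩ := hL
  have hG' : ∀ g : G, g ^ p = 1 := fun g => by rw [← hG]; exact pow_card_eq_one'
  set s : MonoidAlgebra ℤ_[p] G := hat ℤ_[p] (⊤ : Subgroup G) with hs
  have hs' : s = ∑ g : G, MonoidAlgebra.of ℤ_[p] G g := hat_top_eq_sum _
  have hfix : ∀ (g : G) (l : L), MonoidAlgebra.of ℤ_[p] G g • s • l = s • l := fun g l => by
    rw [smul_smul, hs, of_mul_hat _ (Subgroup.mem_top g)]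
  have hsfix : ∀ l : L, (∀ g, MonoidAlgebra.of ℤ_[p] G g • l = l) → s • l = (p : ℤ_[p]) • l := by
    intro l hl
    rw [hs, hat_smul_of_fixed fun g _ => hl g, Subgroup.card_top, hG]
  have hcomm : ∀ (r : MonoidAlgebra ℤ_[p] G) (a : ℤ_[p]) (l : L), r • a • l = a • r • l :=
    fun r a l => (smul_comm a r l).symm
  let S : L →ₗ[ℤ_[p]] L := (LinearMap.lsmul _ _ s).restrictScalars ℤ_[p]
  have hS : ∀ l, S l = s • l := fun _ => rfl
  -- Elementary divisors of `ĜL` in `L`. Each is a unit or an associate of `p`: units will give free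
  -- orbits, the others fixed basis vectors.
  obtain ⟨n, snf⟩ := (LinearMap.range S).smithNormalForm (Module.Free.chooseBasis ℤ_[p] L)
  let v : Fin n → L := fun i => snf.bM (snf.f i)
  have hv : ∀ i, (snf.bN i : L) = snf.a i • v i := snf.snf
  have ha : ∀ i, snf.a i ≠ 0 := fun i hi => snf.bN.ne_zero i (by ext; rw [hv, hi]; simp)
  -- The multiple `snf.a i • v i` is a norm, hence fixed, and `L` is torsion-free.
  have hvfix : ∀ i g, MonoidAlgebra.of ℤ_[p] G g • v i = v i := by
    intro i g
    refine smul_right_injective L (ha i) ?_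
    simp only
    rw [← hcomm, ← hv]
    obtain ⟨l, hl⟩ := (snf.bN i).2
    rw [← hl, hS, hfix]
  have hdvd : ∀ i, ∃ d, snf.a i * d = p := by
    intro i
    have hmem : (p : ℤ_[p]) • v i ∈ LinearMap.range S := ⟨v i, by rw [hS, hsfix _ (hvfix i)]⟩
    have := snf.repr_apply_embedding_eq_repr_smul ⟨_, hmem⟩ (i := i)
    refine ⟨snf.bN.repr ⟨_, hmem⟩ i, ?_⟩
    rw [map_smul snf.bN.repr (snf.a i)] at this
    simpa [v] using this.symm
  -- Generators whose norms are the chosen basis of `ĜL`: any preimage if the divisor is a unit,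
  -- otherwise a unit multiple of the fixed vector `v i`, on which the norm is multiplication by
  -- `p`.
  have hx : ∀ i, ∃ x : L, s • x = snf.a i • v i ∧
      (¬ IsUnit (snf.a i) → ∃ c : ℤ_[p], c ≠ 0 ∧ x = c • v i) := by
    intro i
    by_cases hu : IsUnit (snf.a i)
    · obtain ⟨x, hx⟩ := (snf.bN i).2
      exact ⟨x, by rw [← hv, ← hx, hS], fun h => absurd hu h⟩
    · obtain ⟨d, hd⟩ := hdvd i
      have hd' : IsUnit d := (PadicInt.irreducible_p.isUnit_or_isUnit hd.symm).resolve_left hu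
      obtain ⟨c, hc⟩ := hd'.exists_right_inv
      refine ⟨c • v i, ?_, fun _ => ⟨c, right_ne_zero_of_mul_eq_one hc, rfl⟩⟩
      rw [hcomm, hsfix _ (hvfix i), smul_smul, ← hd]
      congr 1
      linear_combination snf.a i * hc
  choose x hx hx' using hx
  choose! c hc hxc using hx'
  -- Subtracting a combination of the `x i` makes the norm of `l` zero, so the difference lies in
  -- `I_G L` by hypothesis; Nakayama finishes.
  have hgen : Submodule.span (MonoidAlgebra ℤ_[p] G) (Set.range x) = ⊤ := by
    refine eq_top_of_le_sup_augIdeal_smul hG' ⊤ _ fun l _ => ?_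
    let y : LinearMap.range S := ⟨s • l, l, rfl⟩
    have hy : s • l = ∑ i, snf.bN.repr y i • (snf.bN i : L) := by
      have := congrArg (LinearMap.range S).subtype (snf.bN.sum_repr y)
      rw [map_sum] at this
      exact this.symm
    let l' := ∑ i, snf.bN.repr y i • x i
    have h1 : s • (l - l') = 0 := by
      rw [smul_sub, hy, Finset.smul_sum, sub_eq_zero]
      refine Finset.sum_congr rfl fun i _ => ?_
      rw [hcomm, hx, hv]
    have h2 : l = l' + (l - l') := by abel
    rw [h2]
    refine Submodule.add_mem_sup (Submodule.sum_mem _ fun i _ => ?_) (h _ h1)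
    rw [← smul_one_smul (MonoidAlgebra ℤ_[p] G)]
    exact Submodule.smul_mem _ _ (Submodule.subset_span ⟨i, rfl⟩)
  let T := {i : Fin n // IsUnit (snf.a i)}
  let T' := {i : Fin n // ¬ IsUnit (snf.a i)}
  let w : (T × G) ⊕ T' → L :=
    Sum.elim (fun t => MonoidAlgebra.of ℤ_[p] G t.2 • x t.1) (fun t => x t)
  have hxfix : ∀ (t : T') g, MonoidAlgebra.of ℤ_[p] G g • x t = x t := by
    intro t g
    rw [hxc _ t.2, hcomm, hvfix]
  have hspan : ⊤ ≤ Submodule.span ℤ_[p] (Set.range w) := by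
    refine (span_translates_eq_top x hgen _ fun g i => Submodule.subset_span ?_).ge
    by_cases hi : IsUnit (snf.a i)
    · exact ⟨Sum.inl (⟨i, hi⟩, g), rfl⟩
    · exact ⟨Sum.inr ⟨i, hi⟩, (hxfix ⟨i, hi⟩ g).symm⟩
  have hcoord : ∀ i j, snf.bM.coord (snf.f i) (v j) = if j = i then 1 else 0 := by
    intro i j
    simp [v, Finsupp.single_apply]
  have hy : LinearIndependent ℤ_[p] fun t : T' => x t := by
    have h2 : LinearIndependent ℤ_[p] fun j : T' => v j :=
      snf.bM.linearIndependent.comp _ (snf.f.injective.comp Subtype.val_injective)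
    rw [Fintype.linearIndependent_iff] at h2 ⊢
    intro g hg j
    refine (mul_eq_zero.mp (h2 (fun j => g j * c j) ?_ j)).resolve_right (hc _ j.2)
    rw [← hg]
    exact Finset.sum_congr rfl fun j _ => by rw [hxc _ j.2, smul_smul]
  have hind : LinearIndependent ℤ_[p] w := by
    refine linearIndependent_translates hG' (fun t : T => x t) (fun t : T' => x t)
      (fun t => snf.bM.coord (snf.f t)) ?_ hxfix ?_ hy
    · have : (Matrix.of fun i j : T => snf.bM.coord (snf.f i)
          ((∑ g : G, MonoidAlgebra.of ℤ_[p] G g) • x j)) =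
          Matrix.diagonal fun i : T => snf.a i := by
        ext i j
        rw [Matrix.of_apply, ← hs', hx, map_smul, hcoord, Matrix.diagonal_apply]
        by_cases hij : i = j
        · simp [hij]
        · rw [if_neg fun h => hij (Subtype.ext h.symm), if_neg hij, smul_zero]
      rw [this, Matrix.det_diagonal]
      exact IsUnit.prod_univ_iff.mpr fun i => i.2
    · intro i j
      have hij : (j : Fin n) ≠ i := fun h => j.2 (h ▸ i.2)
      rw [hxc _ j.2, map_smul, hcoord, if_neg hij, smul_zero]
  let b := Module.Basis.mk hind hspan
  let e := Fintype.equivFin ((T × G) ⊕ T')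
  refine ⟨_, b.reindex e, fun g i => ?_⟩
  obtain ⟨k, rfl⟩ := e.surjective i
  rcases k with ⟨i, k⟩ | j
  · refine ⟨e (Sum.inl (i, g * k)), ?_⟩
    simp [b, w, smul_smul, MonoidAlgebra.single_mul_single]
  · refine ⟨e (Sum.inr j), ?_⟩
    have := hxfix j g
    simpa [b, w] using this

end Cyclic

/-! ### Tate cohomology of permutation modules. -/

section Permutation

variable {p : ℕ} [Fact p.Prime] {G : Type*} [CommGroup G]
  {L : Type*} [AddCommGroup L] [Module ℤ_[p] L] [Module (MonoidAlgebra ℤ_[p] G) L]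
  [IsScalarTower ℤ_[p] (MonoidAlgebra ℤ_[p] G) L]

/-- Tate cohomology of permutation modules vanishes in degree `-1`. -/
lemma mem_augIdeal_smul_of_isPermutationModule [Finite G] (hL : IsPermutationModule p G L) {l : L}
    (hl : hat ℤ_[p] (⊤ : Subgroup G) • l = 0) :
    l ∈ augIdeal p (⊤ : Subgroup G) • (⊤ : Submodule (MonoidAlgebra ℤ_[p] G) L) := by
  have := Fintype.ofFinite G
  obtain ⟨n, b, hb⟩ := hL
  have : Module.Free ℤ_[p] L := Module.Free.of_basis b
  let r : Setoid (Fin n) :=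
    { r := fun i j => ∃ g : G, MonoidAlgebra.of ℤ_[p] G g • b i = b j
      iseqv :=
        { refl := fun i => ⟨1, by rw [map_one, one_smul]⟩
          symm := by
            rintro i j ⟨g, hg⟩
            exact ⟨g⁻¹, by rw [← hg, smul_smul, ← map_mul, inv_mul_cancel, map_one, one_smul]⟩
          trans := by
            rintro i j k ⟨g, hg⟩ ⟨h, hh⟩
            exact ⟨h * g, by rw [map_mul, mul_smul, hg, hh]⟩ } }
  -- `ρ` chooses a representative in each orbit. Its linear extension `T` is invariant under `G`, so
  -- `Ĝl = 0` gives `|G| T l = 0`, and `l = l - T l` is a combination of differences inside orbits.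
  let ρ : Fin n → Fin n := fun i => (Quotient.mk r i).out
  have hρ : ∀ i, ∃ g : G, MonoidAlgebra.of ℤ_[p] G g • b i = b (ρ i) :=
    fun i => r.symm (Quotient.mk_out i)
  have hρ' : ∀ (g : G) i j, MonoidAlgebra.of ℤ_[p] G g • b i = b j → ρ j = ρ i := by
    intro g i j h
    exact congrArg Quotient.out (Quotient.sound (r.symm ⟨g, h⟩))
  let T : L →ₗ[ℤ_[p]] L := b.constr ℤ_[p] fun i => b (ρ i)
  have hT : ∀ i, T (b i) = b (ρ i) := fun i => b.constr_basis ℤ_[p] _ i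
  have hTg : ∀ (g : G) (m : L), T (MonoidAlgebra.of ℤ_[p] G g • m) = T m := by
    intro g
    have : T ∘ₗ (LinearMap.lsmul _ _ (MonoidAlgebra.of ℤ_[p] G g)).restrictScalars ℤ_[p] = T := by
      refine b.ext fun i => ?_
      obtain ⟨j, hj⟩ := hb g i
      change T (MonoidAlgebra.of ℤ_[p] G g • b i) = _
      rw [hj, hT, hT, hρ' g i j hj]
    exact fun m => LinearMap.congr_fun this m
  have hTl : T l = 0 := by
    have h1 := congrArg T hl
    rw [hat_top_eq_sum, Finset.sum_smul, map_sum, Finset.sum_congr rfl fun g _ => hTg g l, map_zero,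
      Finset.sum_const, ← Nat.cast_smul_eq_nsmul ℤ_[p]] at h1
    exact (smul_eq_zero.mp h1).resolve_left (by simp)
  have hdiff : l - T l = ∑ i, b.repr l i • (b i - b (ρ i)) := by
    conv_lhs => rw [← b.sum_repr l]
    simp only [map_sum, map_smul, hT, smul_sub, Finset.sum_sub_distrib]
  rw [hTl, sub_zero] at hdiff
  rw [hdiff]
  refine Submodule.sum_mem _ fun i _ => Submodule.smul_of_tower_mem _ _ ?_
  obtain ⟨g, hg⟩ := hρ i
  rw [← hg, ← neg_sub, ← Submodule.neg_mem_iff, neg_neg]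
  have : MonoidAlgebra.of ℤ_[p] G g • b i - b i = (MonoidAlgebra.of ℤ_[p] G g - 1) • b i := by
    rw [sub_smul, one_smul]
  rw [this]
  exact Submodule.smul_mem_smul (of_sub_one_mem_augIdeal (Subgroup.mem_top g)) trivial

end Permutation

/-! ### Products of norm elements and the orthogonal idempotents. -/

section Hat

variable {p : ℕ} [Fact p.Prime] {G : Type*} [CommGroup G]

lemma hat_mul_hat_of_le [Finite G] {K H : Subgroup G} (h : K ≤ H) :
    hat ℤ_[p] K * hat ℤ_[p] H = (Nat.card K : ℤ_[p]) • hat ℤ_[p] H :=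
  hat_smul_of_fixed (p := p) (m := hat ℤ_[p] H) fun _ hg => of_mul_hat H (h hg)

lemma coeff_hat [Finite G] (H : Subgroup G) [DecidablePred (· ∈ H)] (g : G) :
    (hat ℤ_[p] H).coeff g = if g ∈ H then 1 else 0 := by
  classical
  have := Fintype.ofFinite H
  rw [hat_eq_sum, MonoidAlgebra.coeff_sum, Finsupp.finsetSum_apply]
  split_ifs with hg
  · rw [Finset.sum_eq_single ⟨g, hg⟩]
    · simp
    · intro h _ hh
      have : (h : G) ≠ g := fun hgh => hh (Subtype.ext hgh)
      simp [this]
    · simp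
  · refine Finset.sum_eq_zero fun h _ => ?_
    have : (h : G) ≠ g := fun hh => hg (hh ▸ h.2)
    simp [this]

/-- The image of `g` in `G ⧸ H` has order `p`, so its powers represent all cosets. -/
lemma bijective_mul_pow [Finite G] (hcard : Nat.card G = p ^ 2) (hG : ∀ g : G, g ^ p = 1)
    {H : Subgroup G} (hH : Nat.card H = p) {g : G} (hg : g ∉ H) :
    Function.Bijective fun x : Fin p × H => (x.2 : G) * g ^ (x.1 : ℕ) := by
  have := Fintype.ofFinite H
  have := Fintype.ofFinite G
  rw [Fintype.bijective_iff_injective_and_card]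
  constructor
  · rintro ⟨i, h⟩ ⟨j, k⟩ hij
    have ho : orderOf (g : G ⧸ H) = p := by
      refine orderOf_eq_prime ?_ fun h1 => hg ((QuotientGroup.eq_one_iff g).mp h1)
      rw [← QuotientGroup.mk_pow, hG, QuotientGroup.mk_one]
    have h1 : (g : G ⧸ H) ^ (i : ℕ) = (g : G ⧸ H) ^ (j : ℕ) := by
      have := congrArg (QuotientGroup.mk (s := H)) hij
      simpa [(QuotientGroup.eq_one_iff _).mpr h.2, (QuotientGroup.eq_one_iff _).mpr k.2] using this
    have h2 : i = j := Fin.ext (pow_injOn_Iio_orderOf (by rw [ho]; exact i.2)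
      (by rw [ho]; exact j.2) h1)
    subst h2
    exact Prod.ext rfl (Subtype.ext (mul_right_cancel hij))
  · rw [Fintype.card_prod, Fintype.card_fin, ← Nat.card_eq_fintype_card, ← Nat.card_eq_fintype_card,
      hH, hcard, sq]

lemma sum_eq_sum_mul_pow [Fintype G] (hcard : Nat.card G = p ^ 2) (hG : ∀ g : G, g ^ p = 1)
    {H : Subgroup G} [Fintype H] (hH : Nat.card H = p) {g : G} (hg : g ∉ H) {A : Type*}
    [AddCommMonoid A] (F : G → A) :
    ∑ k, F k = ∑ i ∈ Finset.range p, ∑ h : H, F (h * g ^ i) := by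
  rw [Finset.sum_range fun i => ∑ h : H, F (h * g ^ i), ← Fintype.sum_prod_type']
  exact (Fintype.sum_bijective _ (bijective_mul_pow hcard hG hH hg) _ _ fun _ => rfl).symm

lemma hat_mul_sum_pow [Finite G] (hcard : Nat.card G = p ^ 2) (hG : ∀ g : G, g ^ p = 1)
    {H : Subgroup G} (hH : Nat.card H = p) {g : G} (hg : g ∉ H) :
    hat ℤ_[p] H * ∑ i ∈ Finset.range p, MonoidAlgebra.of ℤ_[p] G g ^ i =
      hat ℤ_[p] (⊤ : Subgroup G) := by
  have := Fintype.ofFinite H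
  have := Fintype.ofFinite G
  rw [hat_top_eq_sum, sum_eq_sum_mul_pow hcard hG hH hg, hat_eq_sum, Finset.mul_sum]
  refine Finset.sum_congr rfl fun i _ => ?_
  rw [Finset.sum_mul]
  exact Finset.sum_congr rfl fun h _ => by rw [map_mul, map_pow]

lemma exists_mem_not_mem {H K : Subgroup G} (hH : Nat.card H = p) (hK : Nat.card K = p)
    (h : K ≠ H) : ∃ g ∈ K, g ∉ H := by
  have hp : p.Prime := Fact.out
  by_contra! hle
  have : Finite H := Nat.finite_of_card_ne_zero (hH ▸ hp.ne_zero)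
  exact h (Subgroup.eq_of_le_of_card_ge hle (by rw [hH, hK]))

/-- For `g` in `K` but not in `H`, write `Ĝ` as `Ĥ` times the sum of the powers of `g`. That sum
acts on `K̂` as `p`, and `p` cancels in `K̂Ĝ = pĜ`. -/
lemma hat_mul_hat_of_ne [Finite G] (hcard : Nat.card G = p ^ 2) (hG : ∀ g : G, g ^ p = 1)
    {H K : Subgroup G} (hH : Nat.card H = p) (hK : Nat.card K = p) (h : K ≠ H) :
    hat ℤ_[p] H * hat ℤ_[p] K = hat ℤ_[p] (⊤ : Subgroup G) := by
  have hp : p.Prime := Fact.out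
  obtain ⟨g, hgK, hgH⟩ := exists_mem_not_mem hH hK h
  have hpow : ∀ i : ℕ, MonoidAlgebra.of ℤ_[p] G g ^ i * hat ℤ_[p] K = hat ℤ_[p] K := fun i => by
    rw [← map_pow, of_mul_hat K (K.pow_mem hgK i)]
  have h1 : (∑ i ∈ Finset.range p, MonoidAlgebra.of ℤ_[p] G g ^ i) * hat ℤ_[p] K =
      (p : ℤ_[p]) • hat ℤ_[p] K := by
    rw [Finset.sum_mul, Finset.sum_congr rfl fun i _ => hpow i, Finset.sum_const,
      Finset.card_range, Nat.cast_smul_eq_nsmul]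
  have h2 := hat_mul_hat_of_le (p := p) (le_top : K ≤ ⊤)
  rw [mul_comm, ← hat_mul_sum_pow hcard hG hH hgH, mul_assoc, h1, hat_mul_sum_pow hcard hG hH hgH,
    hK, mul_smul_comm] at h2
  exact smul_right_injective _ (Nat.cast_ne_zero.mpr hp.ne_zero) h2

lemma sum_hat [Finite G] [Fintype (OrderP p G)] (hcard : Nat.card G = p ^ 2)
    (hG : ∀ g : G, g ^ p = 1) :
    ∑ H : OrderP p G, hat ℤ_[p] H.1 = (p : ℤ_[p]) • 1 + hat ℤ_[p] (⊤ : Subgroup G) := by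
  classical
  have hp : p.Prime := Fact.out
  -- Each non-identity element lies in exactly one subgroup of order `p`, the identity in all of
  -- them.
  have key : ∑ H : OrderP p G, hat ℤ_[p] H.1 =
      ((Fintype.card (OrderP p G) : ℤ_[p]) - 1) • 1 + hat ℤ_[p] (⊤ : Subgroup G) := by
    ext g
    simp only [MonoidAlgebra.coeff_sum, Finsupp.finsetSum_apply, MonoidAlgebra.coeff_add,
      MonoidAlgebra.coeff_smul, Finsupp.add_apply, Finsupp.smul_apply, coeff_hat, Subgroup.mem_top,
      if_true, MonoidAlgebra.one_def, MonoidAlgebra.coeff_single, Finsupp.single_apply]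
    by_cases hg : g = 1
    · subst hg
      simp
    · have ho : Nat.card (Subgroup.zpowers g) = p := by
        rw [Nat.card_zpowers, orderOf_eq_prime (hG g) hg]
      rw [Finset.sum_eq_single ⟨Subgroup.zpowers g, ho⟩]
      · simp [Ne.symm hg]
      · intro H _ hH
        rw [if_neg]
        intro hgH
        have : Finite H.1 := inferInstance
        refine hH (Subtype.ext (Subgroup.eq_of_le_of_card_ge ?_ ?_).symm)
        · simpa using hgH
        · rw [ho, H.2]
      · simp
  -- The augmentation of `key` counts the subgroups of order `p`.
  have hm : (Fintype.card (OrderP p G) : ℤ_[p]) - 1 = p := by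
    have h1 := congrArg aug key
    simp only [map_sum, aug_hat, map_add, map_smul, map_one, Subgroup.card_top, hcard,
      fun H : OrderP p G => H.2, Finset.sum_const, Finset.card_univ, nsmul_eq_mul, smul_eq_mul,
      mul_one] at h1
    have h2 : ((p : ℤ_[p]) - 1) ≠ 0 := by
      rw [sub_ne_zero]
      exact_mod_cast hp.ne_one
    refine mul_left_cancel₀ h2 ?_
    push_cast at h1
    linear_combination h1
  rw [key, hm]

/-- The elements `p² e_i` of `ℤ_p G`. -/
def scaledIdem (p : ℕ) [Fact p.Prime] {G : Type*} [CommGroup G] :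
    Option (OrderP p G) → MonoidAlgebra ℤ_[p] G
  | none => hat ℤ_[p] (⊤ : Subgroup G)
  | some H => (p : ℤ_[p]) • hat ℤ_[p] H.1 - hat ℤ_[p] (⊤ : Subgroup G)

lemma hat_mul_top [Finite G] {H : Subgroup G} (hH : Nat.card H = p) :
    hat ℤ_[p] H * hat ℤ_[p] (⊤ : Subgroup G) = (p : ℤ_[p]) • hat ℤ_[p] (⊤ : Subgroup G) := by
  rw [hat_mul_hat_of_le le_top, hH]

section

variable [Finite G] (hcard : Nat.card G = p ^ 2) (hG : ∀ g : G, g ^ p = 1)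

include hcard

lemma top_mul_top : hat ℤ_[p] (⊤ : Subgroup G) * hat ℤ_[p] (⊤ : Subgroup G) =
    (p ^ 2 : ℤ_[p]) • hat ℤ_[p] (⊤ : Subgroup G) := by
  rw [hat_mul_hat_of_le le_top, Subgroup.card_top, hcard, Nat.cast_pow]

lemma scaledIdem_mul_self (i : Option (OrderP p G)) :
    scaledIdem p i * scaledIdem p i = (p ^ 2 : ℤ_[p]) • scaledIdem p i := by
  rcases i with _ | H
  · exact top_mul_top hcard
  · have h1 := hat_mul_top H.2
    have h2 := top_mul_top (p := p) hcard
    have h3 := hat_mul_hat_of_le (p := p) (le_refl H.1)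
    rw [H.2] at h3
    simp only [scaledIdem, Algebra.smul_def, map_pow] at *
    linear_combination (algebraMap ℤ_[p] (MonoidAlgebra ℤ_[p] G) p) ^ 2 * h3
      - 2 * (algebraMap ℤ_[p] (MonoidAlgebra ℤ_[p] G) p) * h1 + h2

include hG in
lemma scaledIdem_mul_of_ne {i j : Option (OrderP p G)} (hij : i ≠ j) :
    scaledIdem p i * scaledIdem p j = 0 := by
  have h2 := top_mul_top (p := p) hcard
  have h0 : ∀ K : OrderP p G, scaledIdem p none * scaledIdem p (some K) = 0 := by
    intro K
    have h1 := hat_mul_top K.2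
    simp only [scaledIdem, Algebra.smul_def, map_pow] at *
    linear_combination (algebraMap ℤ_[p] (MonoidAlgebra ℤ_[p] G) p) * h1 - h2
  rcases i with _ | H <;> rcases j with _ | K
  · exact absurd rfl hij
  · exact h0 K
  · rw [mul_comm]
    exact h0 H
  · have hne : K.1 ≠ H.1 := fun h => hij (by rw [Subtype.ext h])
    have h3 := hat_mul_hat_of_ne hcard hG H.2 K.2 hne
    have hH := hat_mul_top H.2
    have hK := hat_mul_top K.2
    simp only [scaledIdem, Algebra.smul_def, map_pow] at *
    linear_combination (algebraMap ℤ_[p] (MonoidAlgebra ℤ_[p] G) p) ^ 2 * h3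
      - (algebraMap ℤ_[p] (MonoidAlgebra ℤ_[p] G) p) * hH
      - (algebraMap ℤ_[p] (MonoidAlgebra ℤ_[p] G) p) * hK + h2

include hG in
lemma sum_scaledIdem [Fintype (OrderP p G)] :
    ∑ i : Option (OrderP p G), scaledIdem p i = (p ^ 2 : ℤ_[p]) • 1 := by
  have hs := sum_hat (p := p) hcard hG
  have hm := congrArg aug hs
  simp only [map_sum, aug_hat, map_add, map_smul, map_one, Subgroup.card_top, hcard,
    fun H : OrderP p G => H.2, Finset.sum_const, Finset.card_univ, nsmul_eq_mul, smul_eq_mul,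
    mul_one, Nat.cast_pow] at hm
  have hp : (p : ℤ_[p]) ≠ 0 := Nat.cast_ne_zero.mpr (Fact.out : p.Prime).ne_zero
  have hm' : (Fintype.card (OrderP p G) : ℤ_[p]) = p + 1 :=
    mul_right_cancel₀ hp (by linear_combination hm)
  rw [Fintype.sum_option]
  simp only [scaledIdem, Finset.sum_sub_distrib, ← Finset.smul_sum, hs, Finset.sum_const,
    Finset.card_univ]
  rw [← Nat.cast_smul_eq_nsmul ℤ_[p], hm']
  simp only [Algebra.smul_def, map_add, map_pow, map_one]
  ring

end

end Hat

/-! ### Splitting off a summand `Λ_(H)`. -/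

section Splitting

variable {p : ℕ} [Fact p.Prime] {G : Type*} [CommGroup G]

lemma sub_one_mul_sum_natCast_mul_pow {R : Type*} [CommRing R] (t : R) (n : ℕ) :
    (t - 1) * ∑ i ∈ Finset.range n, (i : R) * t ^ i =
      n * t ^ n - ∑ i ∈ Finset.range n, t ^ (i + 1) := by
  induction n with
  | zero => simp
  | succ n ih =>
    rw [Finset.sum_range_succ, Finset.sum_range_succ, mul_add, ih]
    push_cast
    ring

lemma sub_one_mul_sum_natCast_mul_pow_of_pow_eq_one {R : Type*} [CommRing R] {t : R} {n : ℕ}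
    (ht : t ^ n = 1) :
    (t - 1) * ∑ i ∈ Finset.range n, (i : R) * t ^ i =
      n - ∑ i ∈ Finset.range n, t ^ i := by
  have h := (Finset.sum_range_succ' (fun i => t ^ i) n).symm.trans (Finset.sum_range_succ _ n)
  rw [sub_one_mul_sum_natCast_mul_pow, ht]
  simp only [ht, pow_zero] at h
  linear_combination - h

lemma of_mul_scaledIdem [Finite G] (H : OrderP p G) {h : G} (hh : h ∈ H.1) :
    MonoidAlgebra.of ℤ_[p] G h * scaledIdem p (some H) = scaledIdem p (some H) := by
  rw [scaledIdem, mul_sub, mul_smul_comm, of_mul_hat _ hh, of_mul_hat _ (Subgroup.mem_top h)]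

section

variable [Finite G] (hcard : Nat.card G = p ^ 2) (hG : ∀ g : G, g ^ p = 1)
  {H : OrderP p G} {g : G} (hg : g ∉ H.1)
include hcard hG hg

/-- Whatever annihilates `(g - 1)Ĥ` thus annihilates `e_H`; this identifies the annihilator of the
generator of the summand. -/
lemma scaledIdem_eq_mul : scaledIdem p (some H) =
    (∑ i ∈ Finset.range p, (i : MonoidAlgebra ℤ_[p] G) * MonoidAlgebra.of ℤ_[p] G g ^ i) *
      ((MonoidAlgebra.of ℤ_[p] G g - 1) * hat ℤ_[p] H.1) := by
  have h1 := hat_mul_sum_pow hcard hG H.2 hg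
  have h2 := sub_one_mul_sum_natCast_mul_pow_of_pow_eq_one (R := MonoidAlgebra ℤ_[p] G)
    (t := MonoidAlgebra.of ℤ_[p] G g) (n := p) (by rw [← map_pow, hG, map_one])
  rw [scaledIdem, Algebra.smul_def, map_natCast]
  linear_combination h1 - hat ℤ_[p] H.1 * h2

lemma sum_pow_mul_scaledIdem :
    (∑ i ∈ Finset.range p, MonoidAlgebra.of ℤ_[p] G g ^ i) * scaledIdem p (some H) = 0 := by
  have h1 := hat_mul_sum_pow hcard hG H.2 hg
  have h2 : (∑ i ∈ Finset.range p, MonoidAlgebra.of ℤ_[p] G g ^ i) *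
      hat ℤ_[p] (⊤ : Subgroup G) = (p : ℤ_[p]) • hat ℤ_[p] (⊤ : Subgroup G) := by
    rw [Finset.sum_mul, Finset.sum_congr rfl fun i _ => by
      rw [← map_pow, of_mul_hat _ (Subgroup.mem_top _)], Finset.sum_const, Finset.card_range,
      Nat.cast_smul_eq_nsmul]
  rw [scaledIdem, mul_sub, mul_smul_comm, mul_comm, h1, h2, sub_self]

variable {U : Type*} [AddCommGroup U] [Module ℤ_[p] U] [Module (MonoidAlgebra ℤ_[p] G) U]
  [IsScalarTower ℤ_[p] (MonoidAlgebra ℤ_[p] G) U]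

/-- The values of the `ℤ_p G`-linear map attached to a functional that factors through `e_H U` are
multiples of `(g - 1) Ĥ`. -/
lemma toGroupAlgebra_eq_mul [Fintype G] (φ : U →ₗ[ℤ_[p]] ℤ_[p])
    (hφ : ∀ h ∈ H.1, ∀ u : U, φ (MonoidAlgebra.of ℤ_[p] G h • u) = φ u) (u : U)
    (hu : φ ((∑ i ∈ Finset.range p, MonoidAlgebra.of ℤ_[p] G g⁻¹ ^ i) • u) = 0) :
    ∃ r : MonoidAlgebra ℤ_[p] G,
      toGroupAlgebra (G := G) φ u = r * ((MonoidAlgebra.of ℤ_[p] G g - 1) * hat ℤ_[p] H.1) ∧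
      aug r = φ ((∑ i ∈ Finset.range p,
        (i : MonoidAlgebra ℤ_[p] G) * MonoidAlgebra.of ℤ_[p] G g⁻¹ ^ i) • u) := by
  have := Fintype.ofFinite H.1
  set t := MonoidAlgebra.of ℤ_[p] G g with ht
  set t' := MonoidAlgebra.of ℤ_[p] G g⁻¹ with ht'
  -- When the coefficients `c_i` sum to zero, `∑ c_i t^i = ∑ c_i (t^i - 1)` is divisible by `t - 1`.
  -- The quotient has augmentation `∑ i c_i`, which is where the weights `i` come from.
  refine ⟨∑ i ∈ Finset.range p, φ (t' ^ i • u) • ∑ j ∈ Finset.range i, t ^ j, ?_, ?_⟩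
  · have h1 : toGroupAlgebra (G := G) φ u = _ := toGroupAlgebra_apply φ u
    have h2 : ∑ i ∈ Finset.range p, φ (t' ^ i • u) = 0 := by
      rw [← map_sum, ← Finset.sum_smul, hu]
    have h3 : ∑ i ∈ Finset.range p, φ (t' ^ i • u) • t ^ i =
        ∑ i ∈ Finset.range p, φ (t' ^ i • u) • ((t - 1) * ∑ j ∈ Finset.range i, t ^ j) := by
      simp_rw [mul_geom_sum, smul_sub, Finset.sum_sub_distrib, ← Finset.sum_smul, h2, zero_smul,
        sub_zero]
    have h4 : toGroupAlgebra (G := G) φ u = (∑ i ∈ Finset.range p, φ (t' ^ i • u) • t ^ i) *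
        hat ℤ_[p] H.1 := by
      rw [h1, sum_eq_sum_mul_pow hcard hG H.2 hg, Finset.sum_mul]
      refine Finset.sum_congr rfl fun i _ => ?_
      rw [hat_eq_sum, Finset.mul_sum]
      refine Finset.sum_congr rfl fun h _ => ?_
      rw [mul_inv, map_mul, mul_smul, hφ _ (H.1.inv_mem h.2), map_mul, ← inv_pow, map_pow, map_pow,
        smul_mul_assoc, mul_comm (t ^ i)]
    rw [h4, h3, ← mul_assoc, Finset.sum_mul _ _ (t - 1)]
    congr 1
    exact Finset.sum_congr rfl fun i _ => by rw [smul_mul_assoc, mul_comm (t - 1)]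
  · rw [Finset.sum_smul, map_sum, map_sum]
    refine Finset.sum_congr rfl fun i _ => ?_
    have h1 : ∀ j ∈ Finset.range i, aug (t ^ j) = 1 := fun j _ => by
      rw [map_pow, ht, MonoidAlgebra.of_apply, aug_single, one_pow]
    rw [map_smul, map_sum, Finset.sum_congr rfl h1, mul_smul,
      ← map_natCast (algebraMap ℤ_[p] (MonoidAlgebra ℤ_[p] G)), algebraMap_smul, φ.map_smul]
    simp [mul_comm]

end

/-- In a free module of finite rank over `ℤ_p`, a vector which is not divisible by `p` has a unit
among its coordinates. -/
lemma exists_isUnit_apply {M : Type*} [AddCommGroup M] [Module ℤ_[p] M] [Module.Free ℤ_[p] M]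
    [Module.Finite ℤ_[p] M] {m : M} (hm : ∀ m' : M, m ≠ (p : ℤ_[p]) • m') :
    ∃ φ : M →ₗ[ℤ_[p]] ℤ_[p], IsUnit (φ m) := by
  let b := Module.Free.chooseBasis ℤ_[p] M
  by_contra! hφ
  have h1 : ∀ i, ∃ c, b.repr m i = p * c := by
    intro i
    have := hφ (b.coord i)
    rwa [PadicInt.not_isUnit_iff, PadicInt.norm_lt_one_iff_dvd] at this
  choose c hc using h1
  refine hm (∑ i, c i • b i) ?_
  conv_lhs => rw [← b.sum_repr m]
  rw [Finset.smul_sum]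
  exact Finset.sum_congr rfl fun i _ => by rw [hc, mul_smul]

variable {U : Type*} [AddCommGroup U] [Module ℤ_[p] U] [Module (MonoidAlgebra ℤ_[p] G) U]
  [IsScalarTower ℤ_[p] (MonoidAlgebra ℤ_[p] G) U]

lemma map_hat [Finite G] (H : Subgroup G) :
    MonoidAlgebra.mapRingHom G (algebraMap ℤ_[p] ℚ_[p]) (hat ℤ_[p] H) = hat ℚ_[p] H := by
  have := Fintype.ofFinite H
  rw [hat_eq_sum, hat_eq_sum, map_sum]
  simp

lemma idem_eq_smul_map [Finite G] (i : Option (OrderP p G)) :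
    idem p i = (1 / (p : ℚ_[p]) ^ 2) •
      MonoidAlgebra.mapRingHom G (algebraMap ℤ_[p] ℚ_[p]) (scaledIdem p i) := by
  rcases i with _ | H
  · rw [idem, scaledIdem, map_hat]
  · rw [idem, scaledIdem, map_sub, map_hat, Algebra.smul_def (p : ℤ_[p]), map_mul, map_hat,
      Algebra.smul_def (p : ℚ_[p])]
    simp

open scoped AlgebraMonoidAlgebra in
lemma smul_idem_eq_zero_iff [Finite G] (i : Option (OrderP p G)) (s : MonoidAlgebra ℤ_[p] G) :
    s • idem p i = 0 ↔ s * scaledIdem p i = 0 := by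
  have hp : (1 / (p : ℚ_[p]) ^ 2) ≠ 0 :=
    one_div_ne_zero (pow_ne_zero _ (Nat.cast_ne_zero.mpr (Fact.out : p.Prime).ne_zero))
  have hinj : Function.Injective (MonoidAlgebra.mapRingHom G (algebraMap ℤ_[p] ℚ_[p])) := by
    intro x y hxy
    ext g
    have := congrArg (fun z => z.coeff g) hxy
    exact FaithfulSMul.algebraMap_injective ℤ_[p] ℚ_[p] (by simpa using this)
  rw [idem_eq_smul_map, Algebra.smul_def, MonoidAlgebra.algebraMap_def, mul_smul_comm,
    smul_eq_zero_iff_right hp, ← map_mul, map_eq_zero_iff _ hinj]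

/-- If `U ∩ e_H U ⊄ I_G e_H U`, then `U` has a direct summand isomorphic to `Λ_(H)`. -/
theorem exists_isCompl_of_notMem [Finite G] (hcard : Nat.card G = p ^ 2)
    (hG : ∀ g : G, g ^ p = 1) (hU : IsLattice p U) (H : OrderP p G) {x y : U}
    (hxy : (p ^ 2 : ℤ_[p]) • x = scaledIdem p (some H) • y)
    (hx : ∀ w ∈ augIdeal p (⊤ : Subgroup G) • (⊤ : Submodule (MonoidAlgebra ℤ_[p] G) U),
      (p ^ 2 : ℤ_[p]) • x ≠ scaledIdem p (some H) • w) :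
    ∃ W W' : Submodule (MonoidAlgebra ℤ_[p] G) U, IsCompl W W' ∧
      Nonempty (W ≃ₗ[MonoidAlgebra ℤ_[p] G] Lam p (some H)) := by
  obtain ⟨_, _⟩ := hU
  have := Fintype.ofFinite G
  have hp : p.Prime := Fact.out
  have hp0 : (p : ℤ_[p]) ≠ 0 := Nat.cast_ne_zero.mpr hp.ne_zero
  have hp2 : (p ^ 2 : ℤ_[p]) ≠ 0 := pow_ne_zero _ hp0
  have hcomm : ∀ (r : MonoidAlgebra ℤ_[p] G) (a : ℤ_[p]) (l : U), r • a • l = a • r • l :=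
    fun r a l => (smul_comm a r l).symm
  set E := scaledIdem p (some H) with hE
  have hEE : E * E = (p ^ 2 : ℤ_[p]) • E := scaledIdem_mul_self hcard _
  have hEx : E • x = (p ^ 2 : ℤ_[p]) • x := by
    refine smul_right_injective U hp2 ?_
    simp only
    rw [← hcomm, hxy, smul_smul, hEE, smul_assoc]
  obtain ⟨g, hg⟩ : ∃ g, g ∉ H.1 := by
    by_contra! hall
    have h1 : H.1 = ⊤ := top_le_iff.mp fun g _ => hall g
    have h2 := H.2
    rw [h1, Subgroup.card_top, hcard] at h2
    have := hp.one_lt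
    nlinarith
  have hg' : g⁻¹ ∉ H.1 := fun h => hg (by simpa using h)
  set t := MonoidAlgebra.of ℤ_[p] G g⁻¹ with ht
  set κ := ∑ i ∈ Finset.range p, t ^ i with hκ
  set D := ∑ i ∈ Finset.range p, (i : MonoidAlgebra ℤ_[p] G) * t ^ i with hD
  have hκE : κ * E = 0 := sum_pow_mul_scaledIdem hcard hG hg'
  have htD : (t - 1) * D = p - κ :=
    sub_one_mul_sum_natCast_mul_pow_of_pow_eq_one (by rw [ht, ← map_pow, hG, map_one])
  let e : U →ₗ[ℤ_[p]] U := (LinearMap.lsmul _ _ E).restrictScalars ℤ_[p]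
  -- `E D x` is not in `p E U`: if it were `p E w`, then `(t - 1) D = p - κ` and `κ E = 0` would
  -- give `p² x = E (t - 1) w`, contrary to `hx`. So some functional on `E U` is a unit there.
  obtain ⟨ψ, hψ⟩ : ∃ ψ : LinearMap.range e →ₗ[ℤ_[p]] ℤ_[p],
      IsUnit (ψ ⟨E • D • x, D • x, rfl⟩) := by
    refine exists_isUnit_apply ?_
    rintro ⟨_, w, rfl⟩ hw
    have hw' : E • D • x = (p : ℤ_[p]) • E • w := congrArg Subtype.val hw
    refine hx ((t - 1) • w) (Submodule.smul_mem_smul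
      (of_sub_one_mem_augIdeal (Subgroup.mem_top _)) trivial) ?_
    refine smul_right_injective U hp0 ?_
    simp only
    have hpx : (p : MonoidAlgebra ℤ_[p] G) • x = (p : ℤ_[p]) • x := by
      rw [← map_natCast (algebraMap ℤ_[p] (MonoidAlgebra ℤ_[p] G)), algebraMap_smul]
    have hκx : E • κ • x = 0 := by rw [smul_smul, mul_comm, hκE, zero_smul]
    calc (p : ℤ_[p]) • (p ^ 2 : ℤ_[p]) • x = E • ((t - 1) * D) • x := by
          rw [htD, sub_smul, smul_sub, hκx, sub_zero, hpx, hcomm, hEx]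
      _ = (t - 1) • E • D • x := by rw [mul_smul, smul_comm E]
      _ = (p : ℤ_[p]) • E • (t - 1) • w := by rw [hw', hcomm, smul_comm E]
  let φ : U →ₗ[ℤ_[p]] ℤ_[p] := ψ ∘ₗ e.rangeRestrict
  have hφ : ∀ h ∈ H.1, ∀ u : U, φ (MonoidAlgebra.of ℤ_[p] G h • u) = φ u := by
    intro h hh u
    refine congrArg ψ (Subtype.ext ?_)
    change E • _ • u = E • u
    rw [smul_smul, mul_comm, of_mul_scaledIdem H hh]
  have hφκ : ∀ u : U, φ (κ • u) = 0 := by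
    intro u
    rw [← map_zero ψ]
    refine congrArg ψ (Subtype.ext ?_)
    change E • κ • u = 0
    rw [smul_smul, mul_comm, hκE, zero_smul]
  let f : U →ₗ[MonoidAlgebra ℤ_[p] G] MonoidAlgebra ℤ_[p] G := toGroupAlgebra φ
  set a := (MonoidAlgebra.of ℤ_[p] G g - 1) * hat ℤ_[p] H.1 with ha
  have hf : ∀ u, ∃ r, f u = r * a ∧ aug r = φ (D • u) := fun u =>
    toGroupAlgebra_eq_mul hcard hG hg φ hφ u (hφκ u)
  obtain ⟨r, hr, hr'⟩ := hf x
  have hru : IsUnit r := isUnit_of_isUnit_aug hG (by rw [hr']; exact hψ)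
  have hEa : ∀ s, s * a = 0 → s * E = 0 := by
    intro s hs
    rw [hE, scaledIdem_eq_mul hcard hG hg, mul_left_comm, ← ha, hs, mul_zero]
  have hfx : ∀ s : MonoidAlgebra ℤ_[p] G, f (s • x) = 0 → s * E = 0 := by
    intro s hs
    rw [map_smul, hr, smul_eq_mul, mul_left_comm] at hs
    exact hEa s (hru.mul_right_eq_zero.mp hs)
  have hsx : ∀ s : MonoidAlgebra ℤ_[p] G, s * E = 0 → s • x = 0 := by
    intro s hs
    refine (smul_eq_zero.mp (?_ : (p ^ 2 : ℤ_[p]) • s • x = 0)).resolve_left hp2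
    rw [← hcomm, ← hEx, smul_smul, hs, zero_smul]
  -- All values of `f` are multiples of `a`, and `f x` is a unit times `a`; so `f` maps the span of
  -- `x` isomorphically onto its image.
  refine ⟨Submodule.span _ {x}, LinearMap.ker f, ⟨?_, ?_⟩, ⟨?_⟩⟩
  · rw [Submodule.disjoint_def]
    intro m hm hm'
    obtain ⟨s, rfl⟩ := Submodule.mem_span_singleton.mp hm
    exact hsx s (hfx s hm')
  · rw [codisjoint_iff_le_sup]
    intro u _
    obtain ⟨s, hs, -⟩ := hf u
    obtain ⟨r', hr''⟩ := hru.exists_left_inv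
    have h1 : f ((s * r') • x) = f u := by
      rw [map_smul, hr, hs, smul_eq_mul]
      linear_combination s * a * hr''
    have h2 : u = (s * r') • x + (u - (s * r') • x) := by abel
    rw [h2]
    exact Submodule.add_mem_sup (Submodule.smul_mem _ _ (Submodule.mem_span_singleton_self x))
      (by rw [LinearMap.mem_ker, map_sub, h1, sub_self])
  · open scoped AlgebraMonoidAlgebra in
    -- Both modules are cyclic, and `x` and `e_H` have the same annihilator.
    refine (Ideal.quotTorsionOfEquivSpanSingleton (MonoidAlgebra ℤ_[p] G) U x).symm ≪≫ₗ
      Submodule.quotEquivOfEq _ _ ?_ ≪≫ₗ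
      Ideal.quotTorsionOfEquivSpanSingleton (MonoidAlgebra ℤ_[p] G)
        (MonoidAlgebra ℚ_[p] G) (idem p (some H))
    ext s
    rw [Ideal.mem_torsionOf_iff, Ideal.mem_torsionOf_iff, smul_idem_eq_zero_iff]
    exact ⟨fun h => hfx s (by rw [h, map_zero]), hsx s⟩

end Splitting

/-! ### The idempotents on `ℚ_p U`, and the intersection condition in `V`. -/

section Extension

variable {p : ℕ} [Fact p.Prime] {G : Type*} [CommGroup G]
  {U : Type*} [AddCommGroup U] [Module ℤ_[p] U] [Module (MonoidAlgebra ℤ_[p] G) U]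
  [IsScalarTower ℤ_[p] (MonoidAlgebra ℤ_[p] G) U]

lemma qAct_tmul (x : MonoidAlgebra ℚ_[p] G) (u : U) (q : ℚ_[p]) :
    qAct p U x (u ⊗ₜ[ℤ_[p]] q) =
      x.coeff.sum fun g a => (MonoidAlgebra.of ℤ_[p] G g • u) ⊗ₜ[ℤ_[p]] (a * q) := by
  rw [qAct, Finsupp.sum, LinearMap.sum_apply, Finsupp.sum]
  refine Finset.sum_congr rfl fun g _ => ?_
  rw [LinearMap.smul_apply, TensorProduct.AlgebraTensorModule.map_tmul, TensorProduct.smul_tmul']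
  rfl

lemma qAct_smul_map_tmul (c : ℚ_[p]) (r : MonoidAlgebra ℤ_[p] G) (u : U) (q : ℚ_[p]) :
    qAct p U (c • MonoidAlgebra.mapRingHom G (algebraMap ℤ_[p] ℚ_[p]) r) (u ⊗ₜ[ℤ_[p]] q) =
      (r • u) ⊗ₜ[ℤ_[p]] (c * q) := by
  induction r using MonoidAlgebra.induction_linear with
  | zero => simp [qAct_tmul]
  | add r s hr hs =>
    rw [map_add, smul_add, qAct_tmul, MonoidAlgebra.coeff_add, Finsupp.sum_add_index',
      ← qAct_tmul, ← qAct_tmul, hr, hs, add_smul, TensorProduct.add_tmul]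
    · simp
    · intro g a b
      rw [add_mul, TensorProduct.tmul_add]
  | single g a =>
    have h1 : c • MonoidAlgebra.mapRingHom G (algebraMap ℤ_[p] ℚ_[p]) (MonoidAlgebra.single g a) =
        MonoidAlgebra.single g (c * a) := by simp
    rw [h1, qAct_tmul, MonoidAlgebra.coeff_single, Finsupp.sum_single_index (by simp),
      ← MonoidAlgebra.smul_of, smul_assoc,
      TensorProduct.smul_tmul a (MonoidAlgebra.of ℤ_[p] G g • u), Algebra.smul_def]
    congr 1
    rw [PadicInt.algebraMap_apply]
    ring

lemma qAct_idem_tmul [Finite G] (i : Option (OrderP p G)) (u : U) (q : ℚ_[p]) :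
    qAct p U (idem p i) (u ⊗ₜ[ℤ_[p]] q) =
      (scaledIdem p i • u) ⊗ₜ[ℤ_[p]] (1 / (p : ℚ_[p]) ^ 2 * q) := by
  rw [idem_eq_smul_map, qAct_smul_map_tmul]

lemma sq_smul_tmul (u : U) (q : ℚ_[p]) :
    ((p ^ 2 : ℤ_[p]) • u) ⊗ₜ[ℤ_[p]] (1 / (p : ℚ_[p]) ^ 2 * q) = u ⊗ₜ[ℤ_[p]] q := by
  have hp : (p : ℚ_[p]) ≠ 0 := Nat.cast_ne_zero.mpr (Fact.out : p.Prime).ne_zero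
  rw [TensorProduct.smul_tmul, Algebra.smul_def, PadicInt.algebraMap_apply]
  congr 1
  push_cast
  field_simp

variable (p G U) in
/-- The embedding `u ↦ u ⊗ 1` of `U` into `ℚ_p U`. -/
def emb : U →ₗ[MonoidAlgebra ℤ_[p] G] QExt p U :=
  (TensorProduct.AlgebraTensorModule.mk ℤ_[p] (MonoidAlgebra ℤ_[p] G) U ℚ_[p]).flip 1

lemma emb_apply (u : U) : emb p G U u = u ⊗ₜ[ℤ_[p]] 1 := rfl

lemma emb_injective [Module.Free ℤ_[p] U] : Function.Injective (emb p G U) := by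
  have h := Module.Flat.lTensor_preserves_injective_linearMap (M := U)
    (Algebra.linearMap ℤ_[p] ℚ_[p]) (FaithfulSMul.algebraMap_injective ℤ_[p] ℚ_[p])
  intro u v huv
  refine (TensorProduct.rid ℤ_[p] U).symm.injective (h ?_)
  simpa [emb_apply] using huv

section

variable [Finite G] (hcard : Nat.card G = p ^ 2)
include hcard

lemma qAct_idem_qAct_idem_self (i : Option (OrderP p G)) (z : QExt p U) :
    qAct p U (idem p i) (qAct p U (idem p i) z) = qAct p U (idem p i) z := by
  induction z using TensorProduct.induction_on with
  | zero => simp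
  | add x y hx hy => rw [map_add, map_add, hx, hy]
  | tmul u q =>
    rw [qAct_idem_tmul, qAct_idem_tmul, smul_smul, scaledIdem_mul_self hcard, smul_assoc,
      sq_smul_tmul]

variable (hG : ∀ g : G, g ^ p = 1)
include hG

lemma qAct_idem_qAct_idem_of_ne {i j : Option (OrderP p G)} (hij : i ≠ j) (z : QExt p U) :
    qAct p U (idem p i) (qAct p U (idem p j) z) = 0 := by
  induction z using TensorProduct.induction_on with
  | zero => simp
  | add x y hx hy => rw [map_add, map_add, hx, hy, add_zero]
  | tmul u q =>
    rw [qAct_idem_tmul, qAct_idem_tmul, smul_smul, scaledIdem_mul_of_ne hcard hG hij, zero_smul,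
      TensorProduct.zero_tmul]

lemma sum_qAct_idem [Fintype (OrderP p G)] (z : QExt p U) :
    ∑ i : Option (OrderP p G), qAct p U (idem p i) z = z := by
  induction z using TensorProduct.induction_on with
  | zero => simp
  | add x y hx hy => simp_rw [map_add, Finset.sum_add_distrib, hx, hy]
  | tmul u q =>
    simp_rw [qAct_idem_tmul]
    rw [← TensorProduct.sum_tmul, ← Finset.sum_smul, sum_scaledIdem hcard hG, smul_assoc, one_smul,
      sq_smul_tmul]

end

/-- The map `U → V` sending `u` to the class of `e_i u`. -/
def toV (i : Option (OrderP p G)) : U →ₗ[MonoidAlgebra ℤ_[p] G] V p G U :=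
  ((latIn p G U).submoduleOf (star p G U)).mkQ ∘ₗ
    (qAct p U (idem p i) ∘ₗ emb p G U).codRestrict (star p G U) fun u =>
      le_iSup (comp p U) i (Submodule.mem_map_of_mem ⟨u, rfl⟩)

lemma range_toV (i : Option (OrderP p G)) : LinearMap.range (toV (U := U) i) = Vcomp p U i := by
  apply le_antisymm
  · rintro _ ⟨u, rfl⟩
    refine ⟨_, ?_, rfl⟩
    exact Submodule.mem_sup_left (Submodule.mem_map_of_mem ⟨u, rfl⟩)
  · rintro _ ⟨z, hz, rfl⟩
    obtain ⟨_, ⟨_, ⟨u, rfl⟩, rfl⟩, l, hl, hul⟩ := Submodule.mem_sup.mp hz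
    refine ⟨u, ?_⟩
    rw [toV, LinearMap.comp_apply, Submodule.mkQ_apply, Submodule.mkQ_apply,
      Submodule.Quotient.eq]
    change _ - (z : QExt p U) ∈ latIn p G U
    change _ = (z : QExt p U) at hul
    rw [← hul]
    change qAct p U (idem p i) (emb p G U u) - (qAct p U (idem p i) (emb p G U u) + l) ∈ _
    rw [sub_add_cancel_left]
    exact (latIn p G U).neg_mem hl

/-- Membership in `I V_(i)` can be lifted to an element of `I U`. -/
lemma smul_Vcomp (I : Ideal (MonoidAlgebra ℤ_[p] G)) (i : Option (OrderP p G)) :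
    I • Vcomp p U i = (I • (⊤ : Submodule (MonoidAlgebra ℤ_[p] G) U)).map (toV i) := by
  rw [← range_toV, Submodule.map_smul'', Submodule.map_top]

variable [Finite G] (hcard : Nat.card G = p ^ 2) (hG : ∀ g : G, g ^ p = 1)
include hcard hG

lemma Vcomp_inf_iSup_le [Module.Free ℤ_[p] U]
    (h : ∀ u : U, hat ℤ_[p] (⊤ : Subgroup G) • u = 0 →
      u ∈ augIdeal p (⊤ : Subgroup G) • (⊤ : Submodule (MonoidAlgebra ℤ_[p] G) U))
    (H : OrderP p G) :
    Vcomp p U (some H) ⊓ (⨆ (K : OrderP p G) (_ : K ≠ H), Vcomp p U (some K)) ≤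
      augIdeal p (⊤ : Subgroup G) • Vcomp p U (some H) := by
  rintro v ⟨hv, hv'⟩
  rw [smul_Vcomp]
  rw [← range_toV] at hv
  obtain ⟨u, rfl⟩ := hv
  -- By orthogonality `Z` contains all `e_K U` with `K ≠ H`; only `e_0 z = e_H z = 0` is needed of
  -- the lift `z`.
  let Z : Submodule (MonoidAlgebra ℤ_[p] G) (QExt p U) :=
    LinearMap.ker (qAct p U (idem p none)) ⊓ LinearMap.ker (qAct p U (idem p (some H)))
  have hle : (⨆ (K : OrderP p G) (_ : K ≠ H), Vcomp p U (some K)) ≤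
      (Z.submoduleOf (star p G U)).map ((latIn p G U).submoduleOf (star p G U)).mkQ := by
    refine iSup₂_le fun K hK => ?_
    rw [← range_toV]
    rintro _ ⟨u, rfl⟩
    refine ⟨_, ⟨?_, ?_⟩, rfl⟩
    · exact qAct_idem_qAct_idem_of_ne hcard hG (Option.some_ne_none K).symm _
    · exact qAct_idem_qAct_idem_of_ne hcard hG (by simpa using hK.symm) _
  obtain ⟨z, ⟨hz0, hzH⟩, hzu⟩ := hle hv'
  replace hz0 : qAct p U (idem p none) (z : QExt p U) = 0 := hz0
  replace hzH : qAct p U (idem p (some H)) (z : QExt p U) = 0 := hzH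
  rw [toV, LinearMap.comp_apply, Submodule.mkQ_apply, Submodule.mkQ_apply, eq_comm,
    Submodule.Quotient.eq] at hzu
  obtain ⟨w, hw⟩ := hzu
  replace hw : emb p G U w = qAct p U (idem p (some H)) (emb p G U u) - z := hw
  have hw0 : hat ℤ_[p] (⊤ : Subgroup G) • w = 0 := by
    have h1 := congrArg (qAct p U (idem (G := G) p none)) hw
    rw [map_sub, hz0, qAct_idem_qAct_idem_of_ne hcard hG (by simp), sub_zero, emb_apply,
      qAct_idem_tmul] at h1
    have h2 := congrArg ((p ^ 2 : ℤ_[p]) • ·) h1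
    simp only [smul_zero, TensorProduct.smul_tmul', sq_smul_tmul] at h2
    exact emb_injective (p := p) (G := G) (h2.trans (map_zero _).symm)
  refine ⟨w, h w hw0, ?_⟩
  have h1 := congrArg (qAct p U (idem p (some H))) hw
  rw [map_sub, hzH, qAct_idem_qAct_idem_self hcard, sub_zero] at h1
  exact congrArg ((latIn p G U).submoduleOf (star p G U)).mkQ (Subtype.ext h1)

lemma exists_scaledIdem_smul_eq [Module.Free ℤ_[p] U] (H : OrderP p G)
    (h : Vcomp p U (some H) ⊓ (⨆ (K : OrderP p G) (_ : K ≠ H), Vcomp p U (some K)) ≤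
      augIdeal p (⊤ : Subgroup G) • Vcomp p U (some H))
    {u : U} (hu : hat ℤ_[p] (⊤ : Subgroup G) • u = 0) :
    ∃ w ∈ augIdeal p (⊤ : Subgroup G) • (⊤ : Submodule (MonoidAlgebra ℤ_[p] G) U), ∃ u' : U,
      scaledIdem p (some H) • u = scaledIdem p (some H) • w + (p ^ 2 : ℤ_[p]) • u' := by
  classical
  have := Fintype.ofFinite (OrderP p G)
  -- The sum of all `e_i u` is `u`, which is zero in `V`, and `e_0 u = 0` because `Ĝu = 0`.
  have hsum : toV (G := G) (some H) u = - ∑ K ∈ Finset.univ.erase H, toV (G := G) (some K) u := by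
    rw [eq_neg_iff_add_eq_zero, Finset.add_sum_erase _ (fun K => toV (G := G) (some K) u)
      (Finset.mem_univ H)]
    have h1 := sum_qAct_idem hcard hG (emb p G U u)
    have h2 : qAct p U (idem (G := G) p none) (emb p G U u) = 0 := by
      rw [emb_apply, qAct_idem_tmul, scaledIdem, hu, TensorProduct.zero_tmul]
    rw [Fintype.sum_option, h2, zero_add] at h1
    simp only [toV, LinearMap.comp_apply]
    rw [← map_sum, Submodule.mkQ_apply, Submodule.Quotient.mk_eq_zero]
    refine ⟨u, ?_⟩
    change emb p G U u = (star p G U).subtype _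
    rw [map_sum]
    exact h1.symm
  have hmem : toV (G := G) (some H) u ∈ augIdeal p (⊤ : Subgroup G) • Vcomp p U (some H) := by
    refine h ⟨range_toV (U := U) (some H) ▸ ⟨u, rfl⟩, ?_⟩
    rw [hsum]
    refine Submodule.neg_mem _ (Submodule.sum_mem _ fun K hK => ?_)
    refine Submodule.mem_iSup_of_mem K (Submodule.mem_iSup_of_mem (Finset.ne_of_mem_erase hK) ?_)
    exact range_toV (U := U) (some K) ▸ ⟨u, rfl⟩
  rw [smul_Vcomp] at hmem
  obtain ⟨w, hw, hwu⟩ := hmem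
  rw [eq_comm, ← sub_eq_zero, ← map_sub, toV, LinearMap.comp_apply, Submodule.mkQ_apply,
    Submodule.Quotient.mk_eq_zero] at hwu
  obtain ⟨u', hu'⟩ := hwu
  replace hu' : emb p G U u' = qAct p U (idem p (some H)) (emb p G U (u - w)) := hu'
  refine ⟨w, hw, u', ?_⟩
  rw [← sub_eq_iff_eq_add', ← smul_sub]
  refine emb_injective (p := p) (G := G) ?_
  rw [emb_apply (u - w), qAct_idem_tmul] at hu'
  have h2 := congrArg ((p ^ 2 : ℤ_[p]) • ·) hu'
  simp only [TensorProduct.smul_tmul', sq_smul_tmul, emb_apply] at h2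
  exact h2.symm

end Extension

/-! ### Passage to the coinvariants. -/

section Coinvariants

variable {p : ℕ} [Fact p.Prime] {G : Type*} [CommGroup G]
  {U : Type*} [AddCommGroup U] [Module ℤ_[p] U] [Module (MonoidAlgebra ℤ_[p] G) U]
  [IsScalarTower ℤ_[p] (MonoidAlgebra ℤ_[p] G) U]

/-- A lattice on which a subgroup `N` of order `p` acts trivially is a permutation module as soon
as its Tate cohomology in degree `-1` vanishes. -/
lemma isPermutationModule_of_fixed [Finite G] (hcard : Nat.card G = p ^ 2)
    (hG : ∀ g : G, g ^ p = 1) {N : Subgroup G} (hN : Nat.card N = p) (hU : IsLattice p U)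
    (hfix : ∀ n ∈ N, ∀ u : U, MonoidAlgebra.of ℤ_[p] G n • u = u)
    (h : ∀ u : U, hat ℤ_[p] (⊤ : Subgroup G) • u = 0 →
      u ∈ augIdeal p (⊤ : Subgroup G) • (⊤ : Submodule (MonoidAlgebra ℤ_[p] G) U)) :
    IsPermutationModule p G U := by
  have hp : p.Prime := Fact.out
  obtain ⟨g, hg⟩ : ∃ g, g ∉ N := by
    by_contra! hall
    have h1 : N = ⊤ := top_le_iff.mp fun g _ => hall g
    rw [h1, Subgroup.card_top, hcard] at hN
    have := hp.one_lt
    nlinarith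
  set C := Subgroup.zpowers g with hC
  have hg1 : g ≠ 1 := fun h => hg (h ▸ N.one_mem)
  have hCcard : Nat.card C = p := by
    rw [Nat.card_zpowers, orderOf_eq_prime (hG g) hg1]
  have hCN : C ≠ N := fun h => hg (h ▸ Subgroup.mem_zpowers g)
  -- `C` is a complement of `N`, and `N` acts trivially, so every element of `G` acts as one of `C`.
  have hdec : ∀ k : G, ∃ c : C, ∀ u : U,
      MonoidAlgebra.of ℤ_[p] G k • u = MonoidAlgebra.of ℤ_[p] G c • u := by
    intro k
    obtain ⟨⟨i, n⟩, rfl⟩ := (bijective_mul_pow hcard hG hN hg).2 k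
    refine ⟨⟨g ^ (i : ℕ), C.pow_mem (Subgroup.mem_zpowers g) _⟩, fun u => ?_⟩
    rw [map_mul, mul_smul, hfix _ n.2]
  let _ : Module (MonoidAlgebra ℤ_[p] C) U :=
    Module.compHom U (MonoidAlgebra.mapDomainRingHom ℤ_[p] C.subtype)
  have hsmul : ∀ (r : MonoidAlgebra ℤ_[p] C) (u : U),
      r • u = MonoidAlgebra.mapDomainRingHom ℤ_[p] C.subtype r • u := fun _ _ => rfl
  have hof : ∀ (c : C) (u : U),
      MonoidAlgebra.of ℤ_[p] C c • u = MonoidAlgebra.of ℤ_[p] G (c : G) • u := by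
    intro c u
    rw [hsmul]
    congr 1
    simp
  have : IsScalarTower ℤ_[p] (MonoidAlgebra ℤ_[p] C) U := by
    refine ⟨fun a r u => ?_⟩
    rw [hsmul, hsmul, ← smul_assoc]
    congr 1
    simp [MonoidAlgebra.mapDomain_smul]
  have key : IsPermutationModule p C U := by
    refine isPermutationModule_of_cyclic hCcard hU fun u hu => ?_
    let S := augIdeal p (⊤ : Subgroup C) • (⊤ : Submodule (MonoidAlgebra ℤ_[p] C) U)
    -- The elements carrying `U` into `I_C U`. It contains `k - 1` for all `k` in `G`, so `I_G U ⊆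
    -- I_C U`.
    let J : Ideal (MonoidAlgebra ℤ_[p] G) :=
      { carrier := {r | ∀ m : U, r • m ∈ S}
        add_mem' := fun ha hb m => by rw [add_smul]; exact S.add_mem (ha m) (hb m)
        zero_mem' := fun m => by rw [zero_smul]; exact S.zero_mem
        smul_mem' := fun c r hr m => by
          rw [smul_eq_mul, mul_comm, mul_smul]
          exact hr _ }
    have hJ : augIdeal p (⊤ : Subgroup G) ≤ J := by
      refine augIdeal_le fun k _ m => ?_
      obtain ⟨c, hc⟩ := hdec k
      rw [sub_smul, one_smul, hc, ← hof]
      have : MonoidAlgebra.of ℤ_[p] C c • m - m = (MonoidAlgebra.of ℤ_[p] C c - 1) • m := by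
        rw [sub_smul, one_smul]
      rw [this]
      exact Submodule.smul_mem_smul (of_sub_one_mem_augIdeal (Subgroup.mem_top c)) trivial
    have hhat : ∀ u : U, hat ℤ_[p] (⊤ : Subgroup C) • u = hat ℤ_[p] C • u := by
      intro u
      have := Fintype.ofFinite C
      rw [hat_top_eq_sum, hat_eq_sum, Finset.sum_smul, Finset.sum_smul]
      exact Finset.sum_congr rfl fun c _ => hof c u
    -- `Ĝ = N̂Ĉ`, so the hypothesis for `G` applies to elements killed by `Ĉ`.
    have hu' : hat ℤ_[p] (⊤ : Subgroup G) • u = 0 := by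
      rw [← hat_mul_hat_of_ne hcard hG hN hCcard hCN, mul_smul, ← hhat, hu, smul_zero]
    refine Submodule.smul_induction_on (h u hu') (p := fun v => v ∈ S) ?_ ?_
    · exact fun r hr m _ => hJ hr m
    · exact fun _ _ => S.add_mem
  obtain ⟨n, b, hb⟩ := key
  refine ⟨n, b, fun k i => ?_⟩
  obtain ⟨c, hc⟩ := hdec k
  obtain ⟨j, hj⟩ := hb c i
  exact ⟨j, by rw [hc, ← hof, hj]⟩

omit [Module ℤ_[p] U] [IsScalarTower ℤ_[p] (MonoidAlgebra ℤ_[p] G) U] in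
lemma hat_smul_eq_zero_of_mem [Finite G] {N : Subgroup G} {u : U}
    (hu : u ∈ augIdeal p N • (⊤ : Submodule (MonoidAlgebra ℤ_[p] G) U)) :
    hat ℤ_[p] N • u = 0 := by
  have hJ : augIdeal p N ≤ Ideal.torsionOf _ _ (hat ℤ_[p] N) := by
    refine augIdeal_le fun g hg => ?_
    rw [Ideal.mem_torsionOf_iff, smul_eq_mul, sub_mul, of_mul_hat N hg, one_mul, sub_self]
  refine Submodule.smul_induction_on hu ?_ ?_
  · intro r hr m _
    have h1 : r * hat ℤ_[p] N = 0 := hJ hr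
    rw [smul_smul, mul_comm, h1, zero_smul]
  · intro x y hx hy
    rw [smul_add, hx, hy, add_zero]

omit [Module ℤ_[p] U] [IsScalarTower ℤ_[p] (MonoidAlgebra ℤ_[p] G) U] in
-- `I_N U ⊆ I_G U`, so `I_G U` is the full preimage of `I_G U_N`.
lemma mk_mem_augIdeal_smul_iff (N : Subgroup G) (u : U) :
    (Submodule.Quotient.mk u : Coinv p U N) ∈
        augIdeal p (⊤ : Subgroup G) • (⊤ : Submodule (MonoidAlgebra ℤ_[p] G) (Coinv p U N)) ↔
      u ∈ augIdeal p (⊤ : Subgroup G) • (⊤ : Submodule (MonoidAlgebra ℤ_[p] G) U) := by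
  have h1 : (augIdeal p (⊤ : Subgroup G) •
      (⊤ : Submodule (MonoidAlgebra ℤ_[p] G) U)).map
        (augIdeal p N • (⊤ : Submodule (MonoidAlgebra ℤ_[p] G) U)).mkQ =
      augIdeal p (⊤ : Subgroup G) • (⊤ : Submodule (MonoidAlgebra ℤ_[p] G) (Coinv p U N)) := by
    rw [Submodule.map_smul'', Submodule.map_top, Submodule.range_mkQ]
  rw [← h1, ← Submodule.mkQ_apply, ← Submodule.mem_comap, Submodule.comap_map_mkQ,
    sup_eq_right.mpr (Submodule.smul_mono_left (augIdeal_mono le_top))]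

end Coinvariants

end ButlerDiagram

end

/-! ### The main theorem. -/

theorem mainTheorem5 (p : ℕ) [Fact p.Prime] {G : Type*} [CommGroup G]
    (hG : Nonempty (G ≃* Multiplicative (ZMod p) × Multiplicative (ZMod p)))
    (N : Subgroup G) (hN : Nat.card N = p)
    (U : Type*) [AddCommGroup U] [Module ℤ_[p] U] [Module (MonoidAlgebra ℤ_[p] G) U]
    [IsScalarTower ℤ_[p] (MonoidAlgebra ℤ_[p] G) U]
    (hU : ButlerDiagram.IsLattice p U) (hred : ButlerDiagram.IsReduced p G U)
    (hUN : ButlerDiagram.IsLattice p (ButlerDiagram.Coinv p U N)) :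
    ButlerDiagram.IsPermutationModule p G (ButlerDiagram.Coinv p U N) ↔
      ∀ H : ButlerDiagram.OrderP p G,
        ButlerDiagram.Vcomp p U (some H) ⊓
            (⨆ (K : ButlerDiagram.OrderP p G) (_ : K ≠ H), ButlerDiagram.Vcomp p U (some K)) ≤
          ButlerDiagram.augIdeal p (⊤ : Subgroup G) • ButlerDiagram.Vcomp p U (some H) := by
  open ButlerDiagram in
  obtain ⟨e⟩ := hG
  have : Finite G := Finite.of_equiv _ e.symm.toEquiv
  have hp0 : (p : ℤ_[p]) ≠ 0 := Nat.cast_ne_zero.mpr (Fact.out : p.Prime).ne_zero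
  have hZ : Nat.card (Multiplicative (ZMod p)) = p := by
    rw [Nat.card_congr Multiplicative.toAdd, Nat.card_zmod]
  have hcard : Nat.card G = p ^ 2 := by
    rw [Nat.card_congr e.toEquiv, Nat.card_prod, hZ, sq]
  have hG' : ∀ g : G, g ^ p = 1 := by
    intro g
    have h1 : ∀ x : Multiplicative (ZMod p), x ^ p = 1 := fun x => by
      have := pow_card_eq_one' (x := x)
      rwa [hZ] at this
    refine e.injective ?_
    rw [map_pow, map_one]
    exact Prod.ext (h1 _) (h1 _)
  have : Module.Free ℤ_[p] U := hU.1
  have : Module.Free ℤ_[p] (Coinv p U N) := hUN.1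
  constructor
  · intro hperm
    refine Vcomp_inf_iSup_le hcard hG' fun u hu => ?_
    rw [← mk_mem_augIdeal_smul_iff N]
    refine mem_augIdeal_smul_of_isPermutationModule hperm ?_
    rw [← Submodule.Quotient.mk_smul, hu, Submodule.Quotient.mk_zero]
  · intro hcond
    have hfix : ∀ n ∈ N, ∀ l : Coinv p U N, MonoidAlgebra.of ℤ_[p] G n • l = l := by
      intro n hn l
      obtain ⟨u, rfl⟩ := Submodule.Quotient.mk_surjective _ l
      rw [← sub_eq_zero, ← Submodule.Quotient.mk_smul, ← Submodule.Quotient.mk_sub,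
        Submodule.Quotient.mk_eq_zero]
      have h1 : MonoidAlgebra.of ℤ_[p] G n • u - u = (MonoidAlgebra.of ℤ_[p] G n - 1) • u := by
        rw [sub_smul, one_smul]
      rw [h1]
      exact Submodule.smul_mem_smul (of_sub_one_mem_augIdeal hn) trivial
    refine isPermutationModule_of_fixed hcard hG' hN hUN hfix fun l hl => ?_
    obtain ⟨u, rfl⟩ := Submodule.Quotient.mk_surjective _ l
    rw [mk_mem_augIdeal_smul_iff]
    -- `Ĝu` lies in `I_N U`, so `N̂` kills it; but `N̂Ĝ = pĜ` and `U` is torsion-free.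
    have hu : hat ℤ_[p] (⊤ : Subgroup G) • u = 0 := by
      rw [← Submodule.Quotient.mk_smul, Submodule.Quotient.mk_eq_zero] at hl
      have h1 := hat_smul_eq_zero_of_mem hl
      rw [smul_smul, hat_mul_top hN, smul_assoc] at h1
      exact (smul_eq_zero.mp h1).resolve_left hp0
    obtain ⟨w, hw, hwu⟩ : ∃ w ∈ augIdeal p (⊤ : Subgroup G) •
        (⊤ : Submodule (MonoidAlgebra ℤ_[p] G) U),
        scaledIdem p (some ⟨N, hN⟩) • u = scaledIdem p (some ⟨N, hN⟩) • w := by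
      obtain ⟨w, hw, x, hx⟩ := exists_scaledIdem_smul_eq hcard hG' ⟨N, hN⟩ (hcond _) hu
      have hx' : (p ^ 2 : ℤ_[p]) • x = scaledIdem p (some ⟨N, hN⟩) • (u - w) := by
        rw [smul_sub, hx, add_sub_cancel_left]
      -- Either `x` can be absorbed into `w`, or it splits off a summand `Λ_(N)`, which reducedness
      -- forbids.
      by_cases hex : ∃ w' ∈ augIdeal p (⊤ : Subgroup G) •
          (⊤ : Submodule (MonoidAlgebra ℤ_[p] G) U),
          (p ^ 2 : ℤ_[p]) • x = scaledIdem p (some ⟨N, hN⟩) • w'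
      · obtain ⟨w', hw', hxw'⟩ := hex
        exact ⟨w + w', Submodule.add_mem _ hw hw', by rw [hx, hxw', smul_add]⟩
      · push Not at hex
        obtain ⟨W, W', hWW', ⟨e⟩⟩ := exists_isCompl_of_notMem hcard hG' hU ⟨N, hN⟩ hx' hex
        exact ((hred W W' hWW').2 _).elim e
    have hw0 := hat_smul_eq_zero_of_mem hw
    -- `Ĝ` kills both `u` and `w`, so on `u - w` the element `p² e_N` acts as `pN̂`.
    have h2 : hat ℤ_[p] N • (u - w) = 0 := by
      refine (smul_eq_zero.mp (?_ : (p : ℤ_[p]) • hat ℤ_[p] N • (u - w) = 0)).resolve_left hp0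
      simp only [scaledIdem, sub_smul, hu, hw0, sub_zero, smul_assoc] at hwu
      rw [smul_sub, smul_sub, hwu, sub_self]
    -- `N` acts trivially on `U_N`, so `N̂` is multiplication by `p` on this torsion-free module.
    have h3 : (Submodule.Quotient.mk (u - w) : Coinv p U N) = 0 := by
      have h4 := hat_smul_of_fixed (m := (Submodule.Quotient.mk (u - w) : Coinv p U N))
        fun n hn => hfix n hn _
      rw [← Submodule.Quotient.mk_smul, h2, Submodule.Quotient.mk_zero, hN] at h4
      exact (smul_eq_zero.mp h4.symm).resolve_left hp0
    rw [Submodule.Quotient.mk_eq_zero] at h3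
    rw [← sub_add_cancel u w]
    exact Submodule.add_mem _ (Submodule.smul_mono_left (augIdeal_mono le_top) h3) hw
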